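/- Let $\mathcal H$ be a real Hilbert space and let $L_0,\Gamma,\Phi\in C^2(\mathcal H,\mathbb R)$. Let $(L_\varepsilon)$ be a family of functionals on $\mathcal H$, of class $C^2$ for $|\varepsilon|$ small, with $$L_\varepsilon=L_0+\varepsilon\,\Gamma+\varepsilon^2\,\Phi+o(\varepsilon^2)\qquad(\varepsilon\to0),$$ where the remainder is $o(\varepsilon^2)$, its gradient is $o(\varepsilon)$ and its Hessian is $o(1)$, each locally uniformly near every point of the set $\mathcal M$ below (in particular, it suffices that the remainder is $o(\varepsilon^2)$ in $C^2$ on bounded sets). Suppose that: (A1) $\mathcal M\subset\mathcal H$ is a $d$-dimensional $C^2$-submanifold with $\nabla L_0(z)=0$ for all $z\in\mathcal M$; (A2) $T_z\mathcal M=\ker\nabla^2L_0(z)$ for all $z\in\mathcal M$; (A3) $\nabla^2L_0(z):\mathcal H\to\mathcal H$ is a Fredholm operator of index zero for all $z\in\mathcal M$; (A4) there are finite-dimensional $C^2$-manifolds without boundary $\mathcal G$ and $\mathcal N$, with $\mathcal N$ compact and non-empty, and a $C^2$-diffeomorphism $\iota:\mathcal G\times\mathcal N\to\mathcal M$ (so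 that $\mathcal M$ is a globally trivial fiber bundle over $\mathcal N$ with fiber $\mathcal G$); (A5) $T_\gamma\mathcal N\subset\ker\nabla(\Gamma\circ\iota)(g,\gamma)$ for all $(g,\gamma)\in\mathcal G\times\mathcal N$. Assume moreover that $\Gamma\circ\iota$ is constant on $\mathcal G\times\mathcal N$. For $z\in\mathcal M$ let $K_z$ be the inverse of the restriction of $\nabla^2L_0(z)$ to $\mathcal W_z:=(T_z\mathcal M)^\perp$, and put $$\hat\Phi(z)=\Phi(z)-\tfrac12\langle K_z\nabla\Gamma(z),\nabla\Gamma(z)\rangle .$$ Suppose that there is an open set $U\subset\mathcal G$ with compact closure $\overline U$ such that $$\inf_{\gamma\in\mathcal N}\Big(\min_{\partial U}\hat\Phi(\iota(\cdot,\gamma))-\min_{\overline U}\hat\Phi(\iota(\cdot,\gamma))\Big)>0\quad\text{or}\quad\sup_{\gamma\in\mathcal N}\Big(\max_{\partial U}\hat\Phi(\iota(\cdot,\gamma))-\max_{\overline U}\hat\Phi(\iota(\cdot,\gamma))\Big)<0$$ (if $\partial U=\emptyset$, it is only required that $U\neq\emptyset$). Then there are $\varepsilon_0>0$ and $C$ such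 that, for every $\varepsilon$ with $|\varepsilon|<\varepsilon_0$, the functional $L_\varepsilon$ has a critical point of the form $z+w$ with $z\in\iota(U\times\mathcal N)\subset\mathcal M$, $w\in\mathcal W_z$ and $\|w\|\le C|\varepsilon|$. -/

import Mathlib

open Set Filter
open scoped Topology Gradient Manifold ContDiff

noncomputable section

namespace DegeneratePerturbation

section HilbertSpace

variable {H : Type*} [NormedAddCommGroup H] [InnerProductSpace ℝ H]

/-- `M` is a `d`-dimensional (embedded) `C²`-submanifold of `H`: near each of its points, a
`C²`-diffeomorphism between open subsets of `H` flattens `M` to a `d`-dimensional subspace. -/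
def IsC2Submanifold (d : ℕ) (M : Set H) : Prop :=
  ∀ z ∈ M, ∃ (e : OpenPartialHomeomorph H H) (V : Submodule ℝ H),
    z ∈ e.source ∧ ContDiffOn ℝ 2 e e.source ∧ ContDiffOn ℝ 2 e.symm e.target ∧
    FiniteDimensional ℝ V ∧ Module.finrank ℝ V = d ∧
    e '' (M ∩ e.source) = (V : Set H) ∩ e.target

/-- The tangent space `T_z M`: the velocities at `z` of curves that run in `M`. For a
`C²`-submanifold these velocities already form a linear subspace, so the span adds nothing. -/
def tangentSpaceOf (M : Set H) (z : H) : Submodule ℝ H :=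
  Submodule.span ℝ
    {v : H | ∃ c : ℝ → H, (∀ᶠ t in 𝓝 0, c t ∈ M) ∧ c 0 = z ∧ HasDerivAt c v 0}

/-- `W_z`, the orthogonal complement of `T_z M` in `H`. -/
def normalSpaceOf (M : Set H) (z : H) : Submodule ℝ H := (tangentSpaceOf M z)ᗮ

/-- A Fredholm operator of index zero. -/
def IsFredholmIndexZero (T : H →L[ℝ] H) : Prop :=
  T.IsFredholm ∧ Module.finrank ℝ T.ker = Module.finrank ℝ (H ⧸ T.range)

variable [CompleteSpace H]

/-- The Hessian `∇²f(z) : H → H`, the derivative of the gradient. -/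
def hessian (f : H → ℝ) (z : H) : H →L[ℝ] H := fderiv ℝ (∇ f) z

/-- `K_z`, the inverse of the restriction of `∇²L₀(z)` to `W_z`: it sends `v` to
the `w ∈ W_z` with `∇²L₀(z) w = v`. (It is only used where such a `w` exists and is unique.) -/
def inverseHessian (L₀ : H → ℝ) (M : Set H) (z : H) : H → H :=
  Function.invFunOn (hessian L₀ z) (normalSpaceOf M z : Set H)

/-- The second-order reduced term `Φ(z) - ½ ⟨K_z(∇Γ(z)), ∇Γ(z)⟩`. -/
def reducedTerm (L₀ Γ Φ : H → ℝ) (M : Set H) (z : H) : ℝ :=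
  Φ z - (1 / 2) * inner ℝ (inverseHessian L₀ M z (∇ Γ z)) (∇ Γ z)

/-- The error of the second-order expansion `L_ε ≈ L_0 + ε Γ + ε² Φ`. -/
def remainder (L : ℝ → H → ℝ) (Γ Φ : H → ℝ) (ε : ℝ) (u : H) : ℝ :=
  L ε u - (L 0 u + ε * Γ u + ε ^ 2 * Φ u)

/-- `L_ε = L_0 + ε Γ + ε² Φ + o(ε²)` near `M`, for a family of `C²` functionals: locally uniformly
at each point of `M`, the remainder is `o(ε²)`, its gradient is `o(ε)` and its Hessian is `o(1)`.
In particular this holds when the remainder is `o(ε²)` in `C²` on bounded sets. -/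
structure HasSecondOrderExpansion (L : ℝ → H → ℝ) (Γ Φ : H → ℝ) (M : Set H) : Prop where
  contDiff : ∀ᶠ ε in 𝓝 (0 : ℝ), ContDiff ℝ 2 (L ε)
  value : ∀ z ∈ M, (fun p : ℝ × H => remainder L Γ Φ p.1 p.2)
    =o[𝓝 (0 : ℝ) ×ˢ 𝓝 z] (fun p => p.1 ^ 2)
  grad : ∀ z ∈ M, (fun p : ℝ × H => (∇ (remainder L Γ Φ p.1)) p.2)
    =o[𝓝 (0 : ℝ) ×ˢ 𝓝 z] (fun p => p.1)
  hess : ∀ z ∈ M, (fun p : ℝ × H => hessian (remainder L Γ Φ p.1) p.2)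
    =o[𝓝 (0 : ℝ) ×ˢ 𝓝 z] (fun _ => (1 : ℝ))

end HilbertSpace

/-- `ι` is a `C²`-diffeomorphism of the product manifold `G × N` onto the submanifold `M` of `H`.
Then `Prod.snd ∘ ι⁻¹ : M → N` is the projection of a globally trivial fiber bundle
with base `N` and fiber `G`, and `ι` is its trivialization. -/
def IsC2DiffeoOnto {H E F G N : Type*} [NormedAddCommGroup H] [NormedSpace ℝ H]
    [NormedAddCommGroup E] [NormedSpace ℝ E] [NormedAddCommGroup F] [NormedSpace ℝ F]
    [TopologicalSpace G] [ChartedSpace E G] [TopologicalSpace N] [ChartedSpace F N]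
    (ι : G × N → H) (M : Set H) : Prop :=
  ContMDiff (𝓘(ℝ, E).prod 𝓘(ℝ, F)) 𝓘(ℝ, H) 2 ι ∧ range ι = M ∧
  ∃ κ : H → G × N, Function.LeftInverse κ ι ∧
    ContMDiffOn 𝓘(ℝ, H) (𝓘(ℝ, E).prod 𝓘(ℝ, F)) 2 κ M

/-- `inf_γ (min_{∂U} φ(·, γ) - min_{closure U} φ(·, γ)) > 0`, written out. -/
def HasUniformInteriorMin {G N : Type*} [TopologicalSpace G] (φ : G × N → ℝ) (U : Set G) : Prop :=
  ∃ c > 0, ∀ γ : N, ∃ g₀ ∈ closure U, ∀ g ∈ frontier U, φ (g₀, γ) + c ≤ φ (g, γ)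

/-- `sup_γ (max_{∂U} φ(·, γ) - max_{closure U} φ(·, γ)) < 0`, written out. -/
def HasUniformInteriorMax {G N : Type*} [TopologicalSpace G] (φ : G × N → ℝ) (U : Set G) : Prop :=
  ∃ c > 0, ∀ γ : N, ∃ g₀ ∈ closure U, ∀ g ∈ frontier U, φ (g, γ) + c ≤ φ (g₀, γ)

end DegeneratePerturbation

end

/-! The proof is a Lyapunov–Schmidt reduction that avoids the implicit function theorem, since no
differentiability in ε is available beyond the expansion at 0. Let P_z be the orthogonal projection
onto W_z. The Hessian ∇²L₀(z) is self-adjoint with closed range and kernel T_zM, hence invertible on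
W_z. So for small ε the auxiliary equation P_z∇L_ε(z+w) = 0 has a solution w(z) ∈ W_z of size O(ε)
(`exists_isAuxSolution`), and small solutions are unique and locally Lipschitz in z
(`eventually_lipschitz_isAuxSolution`).

Because Γ = a on M, ∇Γ(z) lies in W_z, and L_ε(z+w(z)) = L₀(z) + εa + ε²Φ̂(z) + o(ε²) locally
uniformly on M (`eventually_reduced_expansion`). With a sign σ = ±1, all values of σΦ̂ on ι(∂U×N)
exceed its minimum over the compact set ι(Ū×N) by a fixed c > 0. For small ε ≠ 0, a minimizer of
σL_ε(z+w(z)) over the points of ι(Ū×N) on a suitable level of L₀ therefore avoids ι(∂U×N). As L₀ is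
locally constant on M, this is a local extremum on M.

There ξ = ∇L_ε(z+w(z)) is tangent to M. Moving z with velocity -σξ changes σL_ε at rate -‖ξ‖², up to
a contribution of w of at most ½‖ξ‖², because w = O(ε) and P_z is Lipschitz in z. Hence ξ = 0
(`gradient_eq_zero_of_reduced_extremum`). Only Lipschitz dependence of w on z is needed. -/

noncomputable section

namespace DegeneratePerturbation

/-! ### Flattening charts and tangent spaces -/

section Charts

variable {H : Type*} [NormedAddCommGroup H] [InnerProductSpace ℝ H]

/-- A chart that flattens `M` to the subspace `V`. -/
structure IsFlattening (M : Set H) (e : OpenPartialHomeomorph H H) (V : Submodule ℝ H) :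
    Prop where
  contDiffOn : ContDiffOn ℝ 2 e e.source
  contDiffOn_symm : ContDiffOn ℝ 2 e.symm e.target
  finiteDimensional : FiniteDimensional ℝ V
  image_eq : e '' (M ∩ e.source) = (V : Set H) ∩ e.target

lemma IsC2Submanifold.exists_isFlattening {d : ℕ} {M : Set H} (hM : IsC2Submanifold d M) {z : H}
    (hz : z ∈ M) : ∃ (e : OpenPartialHomeomorph H H) (V : Submodule ℝ H),
      z ∈ e.source ∧ IsFlattening M e V := by
  obtain ⟨e, V, h1, h2, h3, h4, -, h6⟩ := hM z hz
  exact ⟨e, V, h1, h2, h3, h4, h6⟩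

namespace IsFlattening

variable {M : Set H} {e : OpenPartialHomeomorph H H} {V : Submodule ℝ H} {z : H}

lemma contDiffAt (h : IsFlattening M e V) (hz : z ∈ e.source) : ContDiffAt ℝ 2 e z :=
  h.contDiffOn.contDiffAt (e.open_source.mem_nhds hz)

lemma contDiffAt_symm (h : IsFlattening M e V) (hz : z ∈ e.source) :
    ContDiffAt ℝ 2 e.symm (e z) :=
  h.contDiffOn_symm.contDiffAt (e.open_target.mem_nhds (e.map_source hz))

lemma hasFDerivAt (h : IsFlattening M e V) (hz : z ∈ e.source) :
    HasFDerivAt e (fderiv ℝ e z) z :=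
  ((h.contDiffAt hz).differentiableAt (by norm_num)).hasFDerivAt

lemma hasFDerivAt_symm (h : IsFlattening M e V) (hz : z ∈ e.source) :
    HasFDerivAt e.symm (fderiv ℝ e.symm (e z)) (e z) :=
  ((h.contDiffAt_symm hz).differentiableAt (by norm_num)).hasFDerivAt

lemma fderiv_symm_fderiv (h : IsFlattening M e V) (hz : z ∈ e.source) (x : H) :
    fderiv ℝ e.symm (e z) (fderiv ℝ e z x) = x := by
  have h1 := (h.hasFDerivAt_symm hz).comp z (h.hasFDerivAt hz)
  have h2 : HasFDerivAt (e.symm ∘ e) (ContinuousLinearMap.id ℝ H) z :=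
    (hasFDerivAt_id z).congr_of_eventuallyEq
      (by filter_upwards [e.open_source.mem_nhds hz] with y hy using e.left_inv hy)
  exact congrArg (fun T : H →L[ℝ] H => T x) (h1.unique h2)

lemma mem_iff (h : IsFlattening M e V) (hz : z ∈ e.source) : z ∈ M ↔ e z ∈ V := by
  constructor
  · intro hm
    exact (h.image_eq.subset ⟨z, ⟨hm, hz⟩, rfl⟩).1
  · intro hv
    obtain ⟨y, ⟨hy, hys⟩, hyz⟩ := h.image_eq.superset ⟨hv, e.map_source hz⟩
    rwa [← e.injOn hys hz hyz]

lemma symm_mem (h : IsFlattening M e V) {y : H} (hy : y ∈ e.target) (hv : y ∈ V) :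
    e.symm y ∈ M := by
  rw [h.mem_iff (e.map_target hy), e.right_inv hy]
  exact hv

/-- The difference quotients of `e ∘ c` lie in `V`, which is closed because it is
finite-dimensional. -/
lemma fderiv_mem (h : IsFlattening M e V) (hz : z ∈ e.source) {c : ℝ → H}
    (hc : ∀ᶠ t in 𝓝 0, c t ∈ M) (hc0 : c 0 = z) {v : H} (hv : HasDerivAt c v 0) :
    fderiv ℝ e z v ∈ V := by
  have := h.finiteDimensional
  have h1 : HasDerivAt (e ∘ c) (fderiv ℝ e z v) 0 := by
    have := h.hasFDerivAt hz
    rw [← hc0] at this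
    rw [← hc0]
    exact this.comp_hasDerivAt 0 hv
  have hcl : IsClosed (V : Set H) := V.closed_of_finiteDimensional
  have h2 := (hasDerivAt_iff_tendsto_slope.1 h1)
  have hcs : ∀ᶠ t in 𝓝 (0 : ℝ), c t ∈ e.source :=
    hv.continuousAt.eventually_mem (hc0 ▸ e.open_source.mem_nhds hz)
  refine hcl.mem_of_tendsto h2 ?_
  have h0 : c 0 ∈ M := hc.self_of_nhds
  filter_upwards [nhdsWithin_le_nhds hc, nhdsWithin_le_nhds hcs] with t ht hts
  rw [slope_def_module]
  refine V.smul_mem _ (V.sub_mem ((h.mem_iff hts).1 ht) ((h.mem_iff ?_).1 h0))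
  exact hc0 ▸ hz

/-- Every vector in the image of `V` is the velocity of a curve in `M`. -/
lemma exists_curve (h : IsFlattening M e V) (hz : z ∈ e.source) (hzM : z ∈ M) {x : H}
    (hx : fderiv ℝ e z x ∈ V) :
    ∃ c : ℝ → H, (∀ᶠ t in 𝓝 0, c t ∈ M) ∧ c 0 = z ∧ HasDerivAt c x 0 := by
  have hline : HasDerivAt (fun t : ℝ => e z + t • fderiv ℝ e z x) (fderiv ℝ e z x) 0 := by
    simpa using ((hasDerivAt_id (0 : ℝ)).smul_const (fderiv ℝ e z x)).const_add (e z)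
  refine ⟨fun t => e.symm (e z + t • fderiv ℝ e z x), ?_, ?_, ?_⟩
  · have : ∀ᶠ t in 𝓝 (0 : ℝ), e z + t • fderiv ℝ e z x ∈ e.target :=
      hline.continuousAt.eventually_mem (by simpa using e.open_target.mem_nhds (e.map_source hz))
    filter_upwards [this] with t ht
    exact h.symm_mem ht (V.add_mem ((h.mem_iff hz).1 hzM) (V.smul_mem _ hx))
  · simp [e.left_inv hz]
  · have h1 : HasFDerivAt e.symm (fderiv ℝ e.symm (e z))
        (e z + (0 : ℝ) • fderiv ℝ e z x) := by
      simpa using h.hasFDerivAt_symm hz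
    simpa [h.fderiv_symm_fderiv hz, Function.comp_def] using h1.comp_hasDerivAt 0 hline

/-- The preimage of `V` under the derivative of the chart is a subspace containing all velocities,
so it contains their span; conversely each of its vectors is itself a velocity. -/
lemma mem_tangentSpaceOf_iff (h : IsFlattening M e V) (hz : z ∈ e.source) (hzM : z ∈ M) {x : H} :
    x ∈ tangentSpaceOf M z ↔ fderiv ℝ e z x ∈ V := by
  constructor
  · intro hx
    have : tangentSpaceOf M z ≤ V.comap (fderiv ℝ e z : H →ₗ[ℝ] H) := by
      refine Submodule.span_le.2 ?_
      rintro v ⟨c, hc, hc0, hv⟩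
      exact h.fderiv_mem hz hc hc0 hv
    exact this hx
  · intro hx
    exact Submodule.subset_span (h.exists_curve hz hzM hx)

lemma fderiv_fderiv_symm (h : IsFlattening M e V) (hz : z ∈ e.source) (x : H) :
    fderiv ℝ e z (fderiv ℝ e.symm (e z) x) = x := by
  have h0 : HasFDerivAt e (fderiv ℝ e z) (e.symm (e z)) := by
    rw [e.left_inv hz]; exact h.hasFDerivAt hz
  have h1 := h0.comp (e z) (h.hasFDerivAt_symm hz)
  have h2 : HasFDerivAt (e ∘ e.symm) (ContinuousLinearMap.id ℝ H) (e z) :=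
    (hasFDerivAt_id (e z)).congr_of_eventuallyEq
      (by filter_upwards [e.open_target.mem_nhds (e.map_source hz)] with y hy
          using e.right_inv hy)
  exact congrArg (fun T : H →L[ℝ] H => T x) (h1.unique h2)

end IsFlattening

lemma IsC2Submanifold.exists_curve {d : ℕ} {M : Set H} (hM : IsC2Submanifold d M) {z x : H}
    (hz : z ∈ M) (hx : x ∈ tangentSpaceOf M z) :
    ∃ c : ℝ → H, (∀ᶠ t in 𝓝 0, c t ∈ M) ∧ c 0 = z ∧ HasDerivAt c x 0 := by
  obtain ⟨e, V, hze, h⟩ := hM.exists_isFlattening hz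
  exact h.exists_curve hze hz ((h.mem_tangentSpaceOf_iff hze hz).1 hx)

/-- A function whose derivative vanishes on `M` is locally constant on `M`. -/
lemma IsC2Submanifold.eventually_eq_of_fderiv_eq_zero {d : ℕ} {M : Set H}
    (hM : IsC2Submanifold d M) {f : H → ℝ} (hf : Differentiable ℝ f)
    (hf0 : ∀ z ∈ M, fderiv ℝ f z = 0) {z : H} (hz : z ∈ M) :
    ∀ᶠ z' in 𝓝 z, z' ∈ M → f z' = f z := by
  obtain ⟨e, V, hze, h⟩ := hM.exists_isFlattening hz
  obtain ⟨r, hr, hball⟩ := Metric.isOpen_iff.1 e.open_target (e z) (e.map_source hze)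
  have hcont : ContinuousAt e z := (h.contDiffAt hze).continuousAt
  filter_upwards [hcont (Metric.ball_mem_nhds _ hr), e.open_source.mem_nhds hze] with z' hz' hs' hM'
  -- In the chart, `M` near `z` becomes a convex piece of `V`, where a vanishing derivative forces
  -- constancy.
  set s : Set V := {v | (v : H) ∈ Metric.ball (e z) r} with hs
  have hsc : Convex ℝ s := (convex_ball (e z) r).linear_preimage V.subtype
  have hso : IsOpen s := Metric.isOpen_ball.preimage continuous_subtype_val
  have hderiv : ∀ v ∈ s, HasFDerivWithinAt (fun v : V => f (e.symm v)) (0 : V →L[ℝ] ℝ) s v := by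
    intro v hv
    have hvt : (v : H) ∈ e.target := hball hv
    have h1 : HasFDerivAt e.symm (fderiv ℝ e.symm v) (v : H) :=
      ((h.contDiffOn_symm.contDiffAt (e.open_target.mem_nhds hvt)).differentiableAt
        (by norm_num)).hasFDerivAt
    have h2 := (hf (e.symm v)).hasFDerivAt
    rw [hf0 _ (h.symm_mem hvt v.2)] at h2
    have h3 := (h2.comp (v : H) h1).comp v (V.subtypeL.hasFDerivAt)
    simpa [Function.comp_def] using h3.hasFDerivWithinAt
  have key := hsc.is_const_of_fderivWithin_eq_zero (𝕜 := ℝ)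
    (f := fun v : V => f (e.symm v)) (fun v hv => (hderiv v hv).differentiableWithinAt)
    (fun v hv => (hderiv v hv).fderivWithin (hso.uniqueDiffWithinAt hv))
    (x := ⟨e z', (h.mem_iff hs').1 hM'⟩) (y := ⟨e z, (h.mem_iff hze).1 hz⟩) hz'
    (by simpa [hs] using hr)
  simpa [e.left_inv hs', e.left_inv hze] using key

end Charts

/-! ### Dependence of the normal projection on the base point -/

section Projections

variable {H : Type*} [NormedAddCommGroup H] [InnerProductSpace ℝ H]

/-- The difference equals P_{Sᗮ}P_T - P_S P_{Tᗮ}. The first product is small because vectors of `T`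
are close to `S`; the second is the adjoint of P_{Tᗮ}P_S, small for the symmetric reason. -/
lemma norm_starProjection_orthogonal_sub_le {S T : Submodule ℝ H} [S.HasOrthogonalProjection]
    [T.HasOrthogonalProjection] {c : ℝ} (hc : 0 ≤ c)
    (hST : ∀ x ∈ S, ∃ y ∈ T, ‖x - y‖ ≤ c * ‖x‖) (hTS : ∀ x ∈ T, ∃ y ∈ S, ‖x - y‖ ≤ c * ‖x‖) :
    ‖Sᗮ.starProjection - Tᗮ.starProjection‖ ≤ 2 * c := by
  have key : ∀ (S T : Submodule ℝ H) [S.HasOrthogonalProjection] [T.HasOrthogonalProjection],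
      (∀ x ∈ S, ∃ y ∈ T, ‖x - y‖ ≤ c * ‖x‖) → ∀ x, ‖Tᗮ.starProjection (S.starProjection x)‖
        ≤ c * ‖x‖ := by
    intro S T _ _ h x
    obtain ⟨y, hy, hxy⟩ := h _ (S.starProjection_apply_mem x)
    have h0 : Tᗮ.starProjection y = 0 := by
      rw [Submodule.starProjection_apply_eq_zero_iff]
      exact T.le_orthogonal_orthogonal hy
    calc ‖Tᗮ.starProjection (S.starProjection x)‖
        = ‖Tᗮ.starProjection (S.starProjection x - y)‖ := by rw [map_sub, h0, sub_zero]
      _ ≤ ‖S.starProjection x - y‖ := Submodule.norm_starProjection_apply_le _ _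
      _ ≤ c * ‖S.starProjection x‖ := hxy
      _ ≤ c * ‖x‖ := by gcongr; exact Submodule.norm_starProjection_apply_le _ _
  have key' : ∀ x, ‖Sᗮ.starProjection (T.starProjection x)‖ ≤ c * ‖x‖ := key T S hTS
  have key2 : ∀ x, ‖S.starProjection (Tᗮ.starProjection x)‖ ≤ c * ‖x‖ := by
    intro x
    set y := S.starProjection (Tᗮ.starProjection x) with hy
    have h1 : ‖y‖ * ‖y‖ ≤ (c * ‖y‖) * ‖x‖ := by
      rw [← real_inner_self_eq_norm_mul_norm]
      nth_rewrite 2 [hy]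
      rw [← Submodule.inner_starProjection_left_eq_right,
        ← Submodule.inner_starProjection_left_eq_right]
      exact (real_inner_le_norm _ _).trans (by gcongr; exact key S T hST y)
    rcases (norm_nonneg y).eq_or_lt with h0 | h0
    · rw [← h0]; positivity
    · nlinarith
  refine ContinuousLinearMap.opNorm_le_bound _ (by positivity) fun x => ?_
  have : (Sᗮ.starProjection - Tᗮ.starProjection) x
      = Sᗮ.starProjection (T.starProjection x) - S.starProjection (Tᗮ.starProjection x) := by
    simp only [Submodule.starProjection_orthogonal_val, sub_apply, map_sub]
    abel
  rw [this]
  exact (norm_sub_le _ _).trans (by linarith [key' x, key2 x])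

variable [CompleteSpace H]

/-- The orthogonal projection onto the normal space `W_z`. -/
def normalProj (M : Set H) (z : H) : H →L[ℝ] H := (tangentSpaceOf M z)ᗮ.starProjection

/-- The normal projection of a `C²`-submanifold is locally Lipschitz. -/
lemma IsC2Submanifold.exists_lipschitz_normalProj {d : ℕ} {M : Set H} (hM : IsC2Submanifold d M)
    {z₀ : H} (hz₀ : z₀ ∈ M) : ∃ Λ : ℝ, 0 ≤ Λ ∧ ∃ s ∈ 𝓝 z₀, ∀ z ∈ s, ∀ z' ∈ s, z ∈ M → z' ∈ M →
      ‖normalProj M z - normalProj M z'‖ ≤ Λ * ‖z - z'‖ := by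
  obtain ⟨e, V, hze, h⟩ := hM.exists_isFlattening hz₀
  have := h.finiteDimensional
  have hJ : ContDiffAt ℝ 1 (fun z => fderiv ℝ e.symm (e z)) z₀ := by
    have h1 : ContDiffAt ℝ 1 (fderiv ℝ e.symm) (e z₀) :=
      (h.contDiffAt_symm hze).fderiv_right (by norm_num)
    exact h1.comp z₀ ((h.contDiffAt hze).of_le (by norm_num))
  obtain ⟨K, t, ht, hK⟩ := hJ.exists_lipschitzOnWith
  have hR : ContinuousAt (fderiv ℝ e) z₀ :=
    ((h.contDiffAt hze).fderiv_right (m := 1) (by norm_num)).continuousAt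
  have hRb : ∀ᶠ z in 𝓝 z₀, ‖fderiv ℝ e z‖ < ‖fderiv ℝ e z₀‖ + 1 :=
    hR.norm.eventually_lt_const (by linarith)
  set b := ‖fderiv ℝ e z₀‖ + 1
  have hb : 0 ≤ b := by positivity
  refine ⟨2 * (K * b), by positivity, t ∩ {z | ‖fderiv ℝ e z‖ < b} ∩ e.source,
    inter_mem (inter_mem ht hRb) (e.open_source.mem_nhds hze), ?_⟩
  have hfd : ∀ z ∈ e.source, z ∈ M → FiniteDimensional ℝ (tangentSpaceOf M z) := by
    intro z hz hzM
    refine Submodule.finiteDimensional_of_le (S₂ := V.map (fderiv ℝ e.symm (e z) : H →ₗ[ℝ] H))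
      fun x hx => ?_
    exact ⟨fderiv ℝ e z x, (h.mem_tangentSpaceOf_iff hz hzM).1 hx, h.fderiv_symm_fderiv hz x⟩
  have main : ∀ z ∈ t ∩ {z | ‖fderiv ℝ e z‖ < b} ∩ e.source,
      ∀ z' ∈ t ∩ {z | ‖fderiv ℝ e z‖ < b} ∩ e.source, z ∈ M → z' ∈ M →
      ∀ x ∈ tangentSpaceOf M z, ∃ y ∈ tangentSpaceOf M z', ‖x - y‖ ≤ (K * b * ‖z - z'‖) * ‖x‖ := by
    rintro z ⟨⟨hzt, hzb⟩, hze⟩ z' ⟨⟨hzt', hzb'⟩, hze'⟩ hzM hzM' x hx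
    -- Transport `x` to the chart at `z` and back at `z'`; going back at `z` would return `x`, so
    -- the error is the variation of the derivative of `e.symm`.
    refine ⟨fderiv ℝ e.symm (e z') (fderiv ℝ e z x), ?_, ?_⟩
    · rw [h.mem_tangentSpaceOf_iff hze' hzM', h.fderiv_fderiv_symm hze']
      exact (h.mem_tangentSpaceOf_iff hze hzM).1 hx
    · nth_rewrite 1 [← h.fderiv_symm_fderiv hze x]
      rw [← sub_apply]
      have h1 := hK.norm_sub_le hzt hzt'
      have hzb : ‖fderiv ℝ e z‖ < b := hzb
      calc _ ≤ ‖fderiv ℝ e.symm (e z) - fderiv ℝ e.symm (e z')‖ * ‖fderiv ℝ e z x‖ :=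
            ContinuousLinearMap.le_opNorm _ _
        _ ≤ (K * ‖z - z'‖) * (b * ‖x‖) := by
            gcongr
            exact (ContinuousLinearMap.le_opNorm _ _).trans (by gcongr)
        _ = _ := by ring
  intro z hz z' hz' hzM hzM'
  have := hfd z hz.2 hzM
  have := hfd z' hz'.2 hzM'
  have h2 := norm_starProjection_orthogonal_sub_le (c := K * b * ‖z - z'‖) (by positivity)
    (main z hz z' hz' hzM hzM')
    (by simpa only [norm_sub_rev z z'] using main z' hz' z hz hzM' hzM)
  calc ‖normalProj M z - normalProj M z'‖ ≤ 2 * (K * b * ‖z - z'‖) := h2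
    _ = 2 * (K * b) * ‖z - z'‖ := by ring

lemma IsC2Submanifold.continuousWithinAt_normalProj {d : ℕ} {M : Set H} (hM : IsC2Submanifold d M)
    {z₀ : H} (hz₀ : z₀ ∈ M) : ContinuousWithinAt (normalProj M) M z₀ := by
  obtain ⟨Λ, hΛ, s, hs, h⟩ := hM.exists_lipschitz_normalProj hz₀
  rw [ContinuousWithinAt, tendsto_iff_norm_sub_tendsto_zero]
  have h1 : Tendsto (fun z => Λ * ‖z - z₀‖) (𝓝[M] z₀) (𝓝 0) := by
    have : Continuous fun z : H => Λ * ‖z - z₀‖ := by fun_prop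
    simpa using (this.tendsto z₀).mono_left nhdsWithin_le_nhds
  refine squeeze_zero' (Eventually.of_forall fun _ => norm_nonneg _) ?_ h1
  filter_upwards [nhdsWithin_le_nhds hs, self_mem_nhdsWithin] with z hzs hzM
  exact h z hzs z₀ (mem_of_mem_nhds hs) hzM hz₀

end Projections

/-! ### Gradients, Hessians and Taylor estimates -/

section Calculus

variable {H : Type*} [NormedAddCommGroup H] [InnerProductSpace ℝ H] [CompleteSpace H]
  {f g : H → ℝ}

lemma contDiff_gradient (hf : ContDiff ℝ 2 f) : ContDiff ℝ 1 (∇ f) :=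
  (InnerProductSpace.toDual ℝ H).symm.contDiff.comp (hf.fderiv_right (by norm_num))

lemma differentiable_gradient (hf : ContDiff ℝ 2 f) : Differentiable ℝ (∇ f) :=
  (contDiff_gradient hf).differentiable one_ne_zero

lemma continuous_gradient (hf : ContDiff ℝ 2 f) : Continuous (∇ f) :=
  (contDiff_gradient hf).continuous

lemma continuous_hessian (hf : ContDiff ℝ 2 f) : Continuous (hessian f) :=
  (contDiff_gradient hf).continuous_fderiv one_ne_zero

lemma inner_hessian (hf : ContDiff ℝ 2 f) (z x y : H) :
    inner ℝ (hessian f z x) y = fderiv ℝ (fderiv ℝ f) z x y := by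
  have h1 : HasFDerivAt (∇ f) (hessian f z) z := (differentiable_gradient hf z).hasFDerivAt
  have h2 : HasFDerivAt (fderiv ℝ f) (fderiv ℝ (fderiv ℝ f) z) z :=
    ((hf.fderiv_right (m := 1) (by norm_num)).differentiable one_ne_zero z).hasFDerivAt
  have h3 := h1.inner ℝ (hasFDerivAt_const y z)
  have h4 := h2.clm_apply (hasFDerivAt_const y z)
  simp only [inner_gradient_left] at h3
  simpa using congrArg (fun T : H →L[ℝ] ℝ => T x) (h3.unique h4)

lemma inner_hessian_comm (hf : ContDiff ℝ 2 f) (z x y : H) :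
    inner ℝ (hessian f z x) y = inner ℝ x (hessian f z y) := by
  rw [inner_hessian hf, real_inner_comm, inner_hessian hf]
  exact (hf.contDiffAt.isSymmSndFDerivAt (by simp)).eq x y

lemma gradient_add_apply (hf : Differentiable ℝ f) (hg : Differentiable ℝ g) :
    ∇ (fun x => f x + g x) = fun x => ∇ f x + ∇ g x := by
  ext1 x
  simp [gradient, fderiv_fun_add (hf x) (hg x)]

lemma gradient_const_mul_apply (c : ℝ) (hf : Differentiable ℝ f) :
    ∇ (fun x => c * f x) = fun x => c • ∇ f x := by
  ext1 x
  simp [gradient, fderiv_const_mul (hf x)]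

lemma hessian_add (hf : ContDiff ℝ 2 f) (hg : ContDiff ℝ 2 g) (z : H) :
    hessian (fun x => f x + g x) z = hessian f z + hessian g z := by
  rw [hessian, gradient_add_apply (hf.differentiable two_ne_zero)
    (hg.differentiable two_ne_zero)]
  exact fderiv_fun_add (differentiable_gradient hf z) (differentiable_gradient hg z)

lemma hessian_const_mul (c : ℝ) (hf : ContDiff ℝ 2 f) (z : H) :
    hessian (fun x => c * f x) z = c • hessian f z := by
  rw [hessian, gradient_const_mul_apply c (hf.differentiable two_ne_zero)]
  exact fderiv_fun_const_smul (differentiable_gradient hf z) c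

lemma norm_gradient_sub_sub_le (hf : ContDiff ℝ 2 f) {A : H →L[ℝ] H} {s : Set H}
    (hs : Convex ℝ s) {η : ℝ} (hA : ∀ u ∈ s, ‖hessian f u - A‖ ≤ η) {u v : H} (hu : u ∈ s)
    (hv : v ∈ s) : ‖∇ f v - ∇ f u - A (v - u)‖ ≤ η * ‖v - u‖ :=
  hs.norm_image_sub_le_of_norm_fderiv_le' (fun x _ => differentiable_gradient hf x) hA hu hv

/-- Mean value inequality along the segment for `f` minus its quadratic model. The operator `A` is a
fixed comparison operator, which lets one `A` serve all functionals and base points nearby. -/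
lemma abs_sub_taylor_le (hf : ContDiff ℝ 2 f) {A : H →L[ℝ] H} {s : Set H}
    (hs : Convex ℝ s) {η : ℝ} (hA : ∀ u ∈ s, ‖hessian f u - A‖ ≤ η) {u w : H} (hu : u ∈ s)
    (hv : u + w ∈ s) :
    |f (u + w) - f u - inner ℝ (∇ f u) w - 1 / 2 * inner ℝ (A w) w| ≤ η * ‖w‖ ^ 2 := by
  have hη : 0 ≤ η := (norm_nonneg _).trans (hA u hu)
  set g : ℝ → ℝ := fun t => f (u + t • w) - t * inner ℝ (∇ f u) w
    - t ^ 2 / 2 * inner ℝ (A w) w with hg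
  have hline : ∀ t : ℝ, HasDerivAt (fun t : ℝ => u + t • w) w t := fun t => by
    simpa using ((hasDerivAt_id t).smul_const w).const_add u
  have hderiv : ∀ t : ℝ, HasDerivAt g (inner ℝ (∇ f (u + t • w) - ∇ f u - A (t • w)) w) t := by
    intro t
    have h1 : HasDerivAt (fun t : ℝ => f (u + t • w)) (inner ℝ (∇ f (u + t • w)) w) t := by
      rw [inner_gradient_left]
      exact ((hf.differentiable two_ne_zero) _).hasFDerivAt.comp_hasDerivAt t (hline t)
    have h2 : HasDerivAt (fun t : ℝ => t ^ 2 / 2) t t := by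
      simpa using (hasDerivAt_pow 2 t).div_const 2
    have h3 := (h1.sub ((hasDerivAt_id t).mul_const (inner ℝ (∇ f u) w))).sub
      (h2.mul_const (inner ℝ (A w) w))
    refine h3.congr_deriv ?_
    simp only [inner_sub_left, map_smul, real_inner_smul_left]
    ring
  have hbound : ∀ t ∈ Ico (0 : ℝ) 1,
      ‖inner ℝ (∇ f (u + t • w) - ∇ f u - A (t • w)) w‖ ≤ η * ‖w‖ ^ 2 := by
    intro t ht
    have hmem : u + t • w ∈ s := by
      have := hs.add_smul_sub_mem hu hv (t := t) ⟨ht.1, ht.2.le⟩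
      simpa using this
    have h1 := norm_gradient_sub_sub_le hf hs hA hu hmem
    rw [add_sub_cancel_left] at h1
    have h2 : ‖t • w‖ ≤ ‖w‖ := by
      rw [norm_smul, Real.norm_eq_abs, abs_of_nonneg ht.1]
      exact mul_le_of_le_one_left (norm_nonneg _) ht.2.le
    calc _ ≤ ‖∇ f (u + t • w) - ∇ f u - A (t • w)‖ * ‖w‖ := norm_inner_le_norm _ _
      _ ≤ (η * ‖w‖) * ‖w‖ := by gcongr; exact h1.trans (by gcongr)
      _ = _ := by ring
  have key := norm_image_sub_le_of_norm_deriv_le_segment_01'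
    (fun t _ => (hderiv t).hasDerivWithinAt) hbound
  rw [Real.norm_eq_abs] at key
  convert key using 2
  simp [hg]
  ring

end Calculus

/-! ### Non-degenerate critical manifolds and the inverse Hessian -/

section LinearAlgebra

variable {H : Type*} [NormedAddCommGroup H] [InnerProductSpace ℝ H] [CompleteSpace H]

lemma range_eq_orthogonal_ker {A : H →L[ℝ] H} (hA : ∀ x y, inner ℝ (A x) y = inner ℝ x (A y))
    (hcl : IsClosed (A.range : Set H)) : A.range = A.kerᗮ := by
  have h1 : A.rangeᗮ = A.ker := by
    ext x
    simp only [Submodule.mem_orthogonal, LinearMap.mem_range, LinearMap.mem_ker,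
      forall_exists_index, forall_apply_eq_imp_iff]
    constructor
    · intro h
      have := h (A x)
      simp only [ContinuousLinearMap.coe_coe] at this ⊢
      rw [hA] at this
      exact inner_self_eq_zero.1 this
    · intro h y
      simp only [ContinuousLinearMap.coe_coe] at h ⊢
      rw [hA, h, inner_zero_right]
  have := hcl.completeSpace_coe
  rw [← h1, Submodule.orthogonal_orthogonal]

end LinearAlgebra

/-- `M` is a non-degenerate critical manifold of `f`. -/
structure IsNondegenerateCritical {H : Type*} [NormedAddCommGroup H] [InnerProductSpace ℝ H]
    [CompleteSpace H] (f : H → ℝ) (M : Set H) : Prop where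
  contDiff : ContDiff ℝ 2 f
  submanifold : ∃ d, IsC2Submanifold d M
  gradient_eq_zero : ∀ z ∈ M, ∇ f z = 0
  ker : ∀ z ∈ M, tangentSpaceOf M z = (hessian f z).ker
  fredholm : ∀ z ∈ M, IsFredholmIndexZero (hessian f z)

/-- The Hessian plus the projection onto the tangent space: the invertible extension to `H` of the
restriction of the Hessian to `W_z`. -/
def augHessian {H : Type*} [NormedAddCommGroup H] [InnerProductSpace ℝ H]
    [CompleteSpace H] (f : H → ℝ) (M : Set H) (z : H) : H →L[ℝ] H :=
  hessian f z + (1 - normalProj M z)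

section NormalProj

variable {H : Type*} [NormedAddCommGroup H] [InnerProductSpace ℝ H] [CompleteSpace H]
  {f : H → ℝ} {M : Set H} {z : H}

lemma normalProj_mem (x : H) : normalProj M z x ∈ normalSpaceOf M z :=
  Submodule.starProjection_apply_mem (tangentSpaceOf M z)ᗮ _

lemma normalProj_eq_self_iff {x : H} : normalProj M z x = x ↔ x ∈ normalSpaceOf M z :=
  Submodule.starProjection_eq_self_iff (K := (tangentSpaceOf M z)ᗮ)

lemma inner_normalProj (x y : H) :
    inner ℝ (normalProj M z x) y = inner ℝ x (normalProj M z y) :=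
  Submodule.inner_starProjection_left_eq_right _ _ _

lemma norm_normalProj_le (x : H) : ‖normalProj M z x‖ ≤ ‖x‖ :=
  Submodule.norm_starProjection_apply_le _ _

lemma inner_eq_zero_of_normalProj_eq_zero {x y : H} (hx : normalProj M z x = 0)
    (hy : y ∈ normalSpaceOf M z) : inner ℝ x y = 0 := by
  rw [← normalProj_eq_self_iff.2 hy, ← inner_normalProj, hx, inner_zero_left]

lemma augHessian_of_mem {w : H} (hw : w ∈ normalSpaceOf M z) :
    augHessian f M z w = hessian f z w := by
  change hessian f z w + (w - normalProj M z w) = _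
  rw [normalProj_eq_self_iff.2 hw, sub_self, add_zero]

namespace IsNondegenerateCritical

lemma mem_tangentSpaceOf_iff (h : IsNondegenerateCritical f M)
    (hz : z ∈ M) {x : H} :
    x ∈ tangentSpaceOf M z ↔ hessian f z x = 0 := by
  rw [h.ker z hz]; exact LinearMap.mem_ker

lemma normalProj_eq_zero_iff (h : IsNondegenerateCritical f M)
    (hz : z ∈ M) {x : H} :
    normalProj M z x = 0 ↔ x ∈ tangentSpaceOf M z := by
  have hcl : IsClosed ((tangentSpaceOf M z) : Set H) := by
    rw [h.ker z hz]; exact (hessian f z).isClosed_ker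
  have := hcl.completeSpace_coe
  rw [normalProj, Submodule.starProjection_apply_eq_zero_iff, Submodule.orthogonal_orthogonal]

lemma range_hessian (h : IsNondegenerateCritical f M)
    (hz : z ∈ M) : (hessian f z).range = normalSpaceOf M z := by
  rw [normalSpaceOf, h.ker z hz]
  exact range_eq_orthogonal_ker (inner_hessian_comm h.contDiff z) (h.fredholm z hz).1.isClosed_range

lemma hessian_mem (h : IsNondegenerateCritical f M)
    (hz : z ∈ M) (x : H) : hessian f z x ∈ normalSpaceOf M z := by
  rw [← h.range_hessian hz]; exact ⟨x, rfl⟩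

lemma normalProj_hessian (h : IsNondegenerateCritical f M)
    (hz : z ∈ M) (x : H) :
    normalProj M z (hessian f z x) = hessian f z x :=
  normalProj_eq_self_iff.2 (h.hessian_mem hz x)

lemma sub_normalProj_mem (h : IsNondegenerateCritical f M)
    (hz : z ∈ M) (x : H) : x - normalProj M z x ∈ tangentSpaceOf M z := by
  rw [← h.normalProj_eq_zero_iff hz, map_sub, normalProj_eq_self_iff.2 (normalProj_mem x), sub_self]

lemma hessian_normalProj (h : IsNondegenerateCritical f M)
    (hz : z ∈ M) (x : H) :
    hessian f z (normalProj M z x) = hessian f z x := by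
  have := (h.mem_tangentSpaceOf_iff hz).1 (h.sub_normalProj_mem hz x)
  rw [map_sub, sub_eq_zero] at this
  exact this.symm

/-- Along H = W_z ⊕ T_zM the operator is block diagonal: the Hessian, which is bijective on W_z, and
the identity on T_zM. -/
lemma augHessian_bijective (h : IsNondegenerateCritical f M)
    (hz : z ∈ M) : Function.Bijective (augHessian f M z) := by
  have happ : ∀ x, augHessian f M z x = hessian f z x + (x - normalProj M z x) := fun x => rfl
  have hP : ∀ x, normalProj M z (augHessian f M z x) = hessian f z x := by
    intro x
    rw [happ, map_add, h.normalProj_hessian hz,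
      (h.normalProj_eq_zero_iff hz).2 (h.sub_normalProj_mem hz x), add_zero]
  constructor
  · rw [injective_iff_map_eq_zero]
    intro x hx
    have h1 : hessian f z x = 0 := by rw [← hP, hx, map_zero]
    have h2 := happ x
    rw [hx, h1, zero_add, (h.normalProj_eq_zero_iff hz).2 ((h.mem_tangentSpaceOf_iff hz).2 h1),
      sub_zero] at h2
    exact h2.symm
  · intro y
    have : normalProj M z y ∈ (hessian f z).range := by
      rw [h.range_hessian hz]; exact normalProj_mem y
    obtain ⟨x, hx⟩ := this
    replace hx : hessian f z x = normalProj M z y := hx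
    refine ⟨normalProj M z x + (y - normalProj M z y), ?_⟩
    rw [happ, map_add, map_add, h.hessian_normalProj hz, hx,
      (h.mem_tangentSpaceOf_iff hz).1 (h.sub_normalProj_mem hz y),
      (h.normalProj_eq_zero_iff hz).2 (h.sub_normalProj_mem hz y),
      normalProj_eq_self_iff.2 (normalProj_mem x)]
    abel

lemma isUnit_augHessian (h : IsNondegenerateCritical f M)
    (hz : z ∈ M) : IsUnit (augHessian f M z) :=
  ContinuousLinearMap.isUnit_iff_bijective.2 (h.augHessian_bijective hz)

lemma continuousWithinAt_augHessian (h : IsNondegenerateCritical f M)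
    (hz : z ∈ M) :
    ContinuousWithinAt (augHessian f M) M z := by
  obtain ⟨d, hM⟩ := h.submanifold
  exact (continuous_hessian h.contDiff).continuousWithinAt.add
    (continuousWithinAt_const.sub (hM.continuousWithinAt_normalProj hz))

/-- `K_z v` solves `∇²f(z) w = v` in `W_z`, for `v ∈ W_z`. -/
lemma inverseHessian_spec (h : IsNondegenerateCritical f M)
    (hz : z ∈ M) {v : H} (hv : v ∈ normalSpaceOf M z) :
    inverseHessian f M z v ∈ normalSpaceOf M z ∧ hessian f z (inverseHessian f M z v) = v := by
  have : ∃ w ∈ (normalSpaceOf M z : Set H), hessian f z w = v := by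
    rw [← h.range_hessian hz] at hv
    obtain ⟨x, hx⟩ := hv
    exact ⟨normalProj M z x, normalProj_mem x, (h.hessian_normalProj hz x).trans hx⟩
  exact ⟨Function.invFunOn_mem this, Function.invFunOn_eq this⟩

/-- On W_z the chosen inverse agrees with the inverse of `augHessian`, and inversion is continuous
at units of the Banach algebra of operators on the fixed space `H`. -/
lemma continuousWithinAt_inverseHessian (h : IsNondegenerateCritical f M)
    (hz : z ∈ M) {v : H → H} (hv : ContinuousWithinAt v M z)
    (hvn : ∀ z ∈ M, v z ∈ normalSpaceOf M z) :
    ContinuousWithinAt (fun z => inverseHessian f M z (v z)) M z := by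
  have hinv : ContinuousWithinAt (fun z => Ring.inverse (augHessian f M z)) M z := by
    obtain ⟨u, hu⟩ := h.isUnit_augHessian hz
    have h1 : ContinuousAt Ring.inverse (augHessian f M z) := hu ▸ NormedRing.inverse_continuousAt u
    exact h1.comp_continuousWithinAt (h.continuousWithinAt_augHessian hz)
  have heq : ∀ z ∈ M, inverseHessian f M z (v z) = Ring.inverse (augHessian f M z) (v z) := by
    intro z hz
    obtain ⟨h1, h2⟩ := h.inverseHessian_spec hz (hvn z hz)
    nth_rewrite 2 [← h2]
    rw [← augHessian_of_mem h1, ← mul_apply_eq_comp,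
      Ring.inverse_mul_cancel _ (h.isUnit_augHessian hz)]
    rfl
  exact (hinv.clm_apply hv).congr heq (heq z hz)

end IsNondegenerateCritical

/-- The gradient of a function that is constant on `M` is normal to `M`. -/
lemma gradient_mem_normalSpaceOf {g : H → ℝ} (hg : Differentiable ℝ g) {a : ℝ}
    (ha : ∀ z ∈ M, g z = a) (z : H) : ∇ g z ∈ normalSpaceOf M z := by
  rw [normalSpaceOf, Submodule.mem_orthogonal]
  intro x hx
  have : tangentSpaceOf M z ≤ LinearMap.ker (fderiv ℝ g z : H →ₗ[ℝ] ℝ) := by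
    refine Submodule.span_le.2 ?_
    rintro v ⟨c, hc, hc0, hv⟩
    have h1 : HasDerivAt (g ∘ c) (fderiv ℝ g z v) 0 := by
      rw [← hc0]
      exact (hg (c 0)).hasFDerivAt.comp_hasDerivAt 0 hv
    have h2 : HasDerivAt (g ∘ c) 0 0 := by
      refine (hasDerivAt_const (0 : ℝ) a).congr_of_eventuallyEq ?_
      filter_upwards [hc] with t ht using ha _ ht
    exact h1.unique h2
  rw [real_inner_comm, inner_gradient_left]
  exact this hx

end NormalProj

lemma eq_add_remainder {H : Type*} {L : ℝ → H → ℝ} {Γ Φ : H → ℝ} (ε : ℝ) :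
    L ε = fun u => L 0 u + ε * Γ u + ε ^ 2 * Φ u + remainder L Γ Φ ε u := by
  ext u
  simp [remainder]

lemma contDiff_remainder {H : Type*} [NormedAddCommGroup H] [InnerProductSpace ℝ H]
    {L : ℝ → H → ℝ} {Γ Φ : H → ℝ} (h0 : ContDiff ℝ 2 (L 0)) (hΓ : ContDiff ℝ 2 Γ) (hΦ : ContDiff ℝ 2 Φ)
    {ε : ℝ} (hε : ContDiff ℝ 2 (L ε)) : ContDiff ℝ 2 (remainder L Γ Φ ε) :=
  hε.sub ((h0.add (contDiff_const.mul hΓ)).add (contDiff_const.mul hΦ))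

lemma eventually_fst_lt {H : Type*} [TopologicalSpace H] {b C : ℝ} (hb : 0 < b) (z₀ : H) :
    ∀ᶠ p in 𝓝 (0 : ℝ) ×ˢ 𝓝 z₀, C * |p.1| < b := by
  have : Tendsto (fun ε : ℝ => C * |ε|) (𝓝 0) (𝓝 (C * |0|)) :=
    (by fun_prop : Continuous fun ε : ℝ => C * |ε|).tendsto 0
  rw [abs_zero, mul_zero] at this
  exact tendsto_fst.eventually (this.eventually_lt_const hb)

/-! ### Expansion of gradients and Hessians in ε -/

section Expansion

variable {H : Type*} [NormedAddCommGroup H] [InnerProductSpace ℝ H] [CompleteSpace H]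
  {L : ℝ → H → ℝ} {Γ Φ : H → ℝ} {M : Set H}

lemma gradient_expansion (h0 : ContDiff ℝ 2 (L 0)) (hΓ : ContDiff ℝ 2 Γ) (hΦ : ContDiff ℝ 2 Φ)
    {ε : ℝ} (hε : ContDiff ℝ 2 (L ε)) (u : H) :
    ∇ (L ε) u = ∇ (L 0) u + ε • ∇ Γ u + ε ^ 2 • ∇ Φ u + ∇ (remainder L Γ Φ ε) u := by
  have d0 := h0.differentiable two_ne_zero
  have dΓ := hΓ.differentiable two_ne_zero
  have dΦ := hΦ.differentiable two_ne_zero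
  have dR := (contDiff_remainder h0 hΓ hΦ hε).differentiable two_ne_zero
  nth_rewrite 1 [eq_add_remainder (L := L) (Γ := Γ) (Φ := Φ) ε]
  rw [gradient_add_apply ((d0.fun_add (dΓ.const_mul ε)).fun_add (dΦ.const_mul _)) dR,
    gradient_add_apply (d0.fun_add (dΓ.const_mul ε)) (dΦ.const_mul _),
    gradient_add_apply d0 (dΓ.const_mul ε),
    gradient_const_mul_apply _ dΓ, gradient_const_mul_apply _ dΦ]

lemma hessian_expansion (h0 : ContDiff ℝ 2 (L 0)) (hΓ : ContDiff ℝ 2 Γ) (hΦ : ContDiff ℝ 2 Φ)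
    {ε : ℝ} (hε : ContDiff ℝ 2 (L ε)) (u : H) :
    hessian (L ε) u = hessian (L 0) u + ε • hessian Γ u + ε ^ 2 • hessian Φ u
      + hessian (remainder L Γ Φ ε) u := by
  have cΓ : ContDiff ℝ 2 fun u => ε * Γ u := contDiff_const.mul hΓ
  have cΦ : ContDiff ℝ 2 fun u => ε ^ 2 * Φ u := contDiff_const.mul hΦ
  have cR := contDiff_remainder h0 hΓ hΦ hε
  nth_rewrite 1 [eq_add_remainder (L := L) (Γ := Γ) (Φ := Φ) ε]
  rw [hessian_add ((h0.add cΓ).add cΦ) cR, hessian_add (h0.add cΓ) cΦ, hessian_add h0 cΓ,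
    hessian_const_mul _ hΓ, hessian_const_mul _ hΦ]

lemma eventually_contDiff (hL : HasSecondOrderExpansion L Γ Φ M) (z₀ : H) :
    ∀ᶠ p in 𝓝 (0 : ℝ) ×ˢ 𝓝 z₀, ContDiff ℝ 2 (L p.1) :=
  tendsto_fst.eventually hL.contDiff

lemma tendsto_hessian (h0 : ContDiff ℝ 2 (L 0)) (hΓ : ContDiff ℝ 2 Γ) (hΦ : ContDiff ℝ 2 Φ)
    (hL : HasSecondOrderExpansion L Γ Φ M) {z₀ : H} (hz₀ : z₀ ∈ M) :
    Tendsto (fun p : ℝ × H => hessian (L p.1) p.2) (𝓝 (0 : ℝ) ×ˢ 𝓝 z₀)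
      (𝓝 (hessian (L 0) z₀)) := by
  have hR := hL.hess z₀ hz₀
  rw [Asymptotics.isLittleO_one_iff] at hR
  have c1 : Continuous fun p : ℝ × H => hessian (L 0) p.2 + p.1 • hessian Γ p.2
      + p.1 ^ 2 • hessian Φ p.2 := by
    have := continuous_hessian h0
    have := continuous_hessian hΓ
    have := continuous_hessian hΦ
    fun_prop
  have h1 := (c1.tendsto (0, z₀)).add (nhds_prod_eq (x := (0 : ℝ)) (y := z₀) ▸ hR)
  simp only [zero_smul, add_zero, ne_eq, OfNat.ofNat_ne_zero, not_false_eq_true, zero_pow] at h1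
  rw [nhds_prod_eq] at h1
  refine h1.congr' ?_
  filter_upwards [eventually_contDiff hL z₀] with p hp
  exact (hessian_expansion h0 hΓ hΦ hp p.2).symm

/-- Near a point of `M` the Hessians of all `L_ε` are close to one operator. -/
lemma exists_hessian_close (h0 : ContDiff ℝ 2 (L 0)) (hΓ : ContDiff ℝ 2 Γ) (hΦ : ContDiff ℝ 2 Φ)
    (hL : HasSecondOrderExpansion L Γ Φ M) {z₀ : H} (hz₀ : z₀ ∈ M) {η : ℝ} (hη : 0 < η) :
    ∃ r > 0, ∀ᶠ ε in 𝓝 (0 : ℝ), ContDiff ℝ 2 (L ε) ∧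
      ∀ u ∈ Metric.ball z₀ r, ‖hessian (L ε) u - hessian (L 0) z₀‖ ≤ η := by
  have h1 := (tendsto_hessian h0 hΓ hΦ hL hz₀).eventually (Metric.ball_mem_nhds _ hη)
  obtain ⟨pa, ha, pb, hb, h⟩ := eventually_prod_iff.1 h1
  obtain ⟨r, hr, hball⟩ := Metric.eventually_nhds_iff_ball.1 hb
  refine ⟨r, hr, ?_⟩
  filter_upwards [ha, hL.contDiff] with ε hε hc
  refine ⟨hc, fun u hu => ?_⟩
  exact (mem_ball_iff_norm.1 (h hε (hball u hu))).le

/-- On `M` the gradient of `L_ε` is `ε ∇Γ + o(ε)`. -/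
lemma eventually_gradient_close (h0 : IsNondegenerateCritical (L 0) M) (hΓ : ContDiff ℝ 2 Γ)
    (hΦ : ContDiff ℝ 2 Φ) (hL : HasSecondOrderExpansion L Γ Φ M) {z₀ : H} (hz₀ : z₀ ∈ M) {η : ℝ}
    (hη : 0 < η) : ∀ᶠ p in 𝓝 (0 : ℝ) ×ˢ 𝓝 z₀, p.2 ∈ M →
      ‖∇ (L p.1) p.2 - p.1 • ∇ Γ p.2‖ ≤ η * |p.1| := by
  have hR := (hL.grad z₀ hz₀).def (half_pos hη)
  have hb : ∀ᶠ p in 𝓝 (0 : ℝ) ×ˢ 𝓝 z₀, ‖∇ Φ p.2‖ < ‖∇ Φ z₀‖ + 1 :=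
    tendsto_snd.eventually
      ((continuous_gradient hΦ).norm.continuousAt.eventually_lt_const (by linarith))
  filter_upwards [hR, hb, eventually_contDiff hL z₀,
    eventually_fst_lt (C := ‖∇ Φ z₀‖ + 1) (half_pos hη) z₀] with p hp hpb hc hε hz
  rw [gradient_expansion h0.contDiff hΓ hΦ hc, h0.gradient_eq_zero _ hz, zero_add]
  have h1 : ‖p.1 ^ 2 • ∇ Φ p.2‖ ≤ η / 2 * |p.1| := by
    rw [norm_smul, norm_pow, Real.norm_eq_abs]
    calc |p.1| ^ 2 * ‖∇ Φ p.2‖ ≤ |p.1| ^ 2 * (‖∇ Φ z₀‖ + 1) := by gcongr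
      _ = ((‖∇ Φ z₀‖ + 1) * |p.1|) * |p.1| := by ring
      _ ≤ _ := by gcongr
  have h2 : p.1 • ∇ Γ p.2 + p.1 ^ 2 • ∇ Φ p.2 + ∇ (remainder L Γ Φ p.1) p.2 - p.1 • ∇ Γ p.2
      = p.1 ^ 2 • ∇ Φ p.2 + ∇ (remainder L Γ Φ p.1) p.2 := by abel
  rw [h2]
  rw [Real.norm_eq_abs] at hp
  exact (norm_add_le _ _).trans (by linarith)

end Expansion

/-! ### The auxiliary equation -/

section AuxiliaryEquation

variable {H : Type*} [NormedAddCommGroup H] [InnerProductSpace ℝ H] [CompleteSpace H]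
  {L : ℝ → H → ℝ} {Γ Φ : H → ℝ} {M : Set H}

/-- `w ∈ W_z` solves the auxiliary equation: the component in `W_z` of `∇f(z + w)` vanishes. -/
def IsAuxSolution (f : H → ℝ) (M : Set H) (z w : H) : Prop :=
  w ∈ normalSpaceOf M z ∧ normalProj M z (∇ f (z + w)) = 0

/-- The map whose zeros are the solutions of the auxiliary equation. -/
def auxMap (f : H → ℝ) (M : Set H) (z w : H) : H :=
  normalProj M z (∇ f (z + w)) + (w - normalProj M z w)

/-- The two summands of `auxMap` lie in complementary subspaces, so they vanish separately. This
replaces an equation in the moving space W_z by one in all of `H`. -/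
lemma isAuxSolution_iff {f : H → ℝ} {z w : H} : IsAuxSolution f M z w ↔ auxMap f M z w = 0 := by
  have hid : ∀ x, normalProj M z (normalProj M z x) = normalProj M z x :=
    fun x => normalProj_eq_self_iff.2 (normalProj_mem x)
  rw [IsAuxSolution, auxMap]
  constructor
  · rintro ⟨h1, h2⟩
    rw [h2, normalProj_eq_self_iff.2 h1, sub_self, add_zero]
  · intro h
    have h1 := congrArg (normalProj M z) h
    rw [map_add, map_sub, hid, hid, sub_self, add_zero, map_zero] at h1
    rw [h1, zero_add, sub_eq_zero] at h
    exact ⟨normalProj_eq_self_iff.1 h.symm, h1⟩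

lemma IsNondegenerateCritical.exists_bound {f : H → ℝ} (h : IsNondegenerateCritical f M) {z : H}
    (hz : z ∈ M) : ∃ b > 0, ∀ x, ‖x‖ ≤ b * ‖augHessian f M z x‖ := by
  obtain ⟨u, hu⟩ := h.isUnit_augHessian hz
  refine ⟨‖(↑u⁻¹ : H →L[ℝ] H)‖ + 1, by positivity, fun x => ?_⟩
  have h1 : (↑u⁻¹ : H →L[ℝ] H) (augHessian f M z x) = x := by
    rw [← hu, ← mul_apply_eq_comp, u.inv_mul]
    rfl
  calc ‖x‖ = ‖(↑u⁻¹ : H →L[ℝ] H) (augHessian f M z x)‖ := by rw [h1]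
    _ ≤ ‖(↑u⁻¹ : H →L[ℝ] H)‖ * ‖augHessian f M z x‖ := ContinuousLinearMap.le_opNorm _ _
    _ ≤ _ := by gcongr; linarith

/-- `auxMap (L ε) M z` is close to the invertible operator `augHessian (L 0) M z₀`, uniformly
for `ε` near `0` and `z ∈ M` near `z₀`. -/
lemma exists_auxMap_close (h0 : IsNondegenerateCritical (L 0) M) (hΓ : ContDiff ℝ 2 Γ)
    (hΦ : ContDiff ℝ 2 Φ) (hL : HasSecondOrderExpansion L Γ Φ M) {z₀ : H} (hz₀ : z₀ ∈ M) {c : ℝ}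
    (hc : 0 < c) : ∃ r > 0, ∀ᶠ p in 𝓝 (0 : ℝ) ×ˢ 𝓝 z₀, p.2 ∈ M →
      ∀ w ∈ Metric.ball (0 : H) r, ∀ w' ∈ Metric.ball (0 : H) r,
      ‖auxMap (L p.1) M p.2 w - auxMap (L p.1) M p.2 w' - augHessian (L 0) M z₀ (w - w')‖
        ≤ c * ‖w - w'‖ := by
  obtain ⟨r, hr, hr'⟩ := exists_hessian_close h0.contDiff hΓ hΦ hL hz₀ (half_pos hc)
  set A := hessian (L 0) z₀ with hA
  -- Half of `c` pays for the variation of the Hessian. The variation of the projection enters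
  -- twice, applied to `A (w - w')` and to `w - w'`, and `τ` makes both together cost the other
  -- half.
  set τ := c / (2 * (‖A‖ + 1)) with hτ
  have hτ0 : 0 < τ := by positivity
  have hτc : τ * ‖A‖ + τ = c / 2 := by rw [hτ]; field_simp
  refine ⟨r / 2, by positivity, ?_⟩
  obtain ⟨d, hM⟩ := h0.submanifold
  have hP : ∀ᶠ z in 𝓝 z₀, z ∈ M → ‖normalProj M z - normalProj M z₀‖ < τ := by
    have := (hM.continuousWithinAt_normalProj hz₀).eventually (Metric.ball_mem_nhds _ hτ0)
    rw [eventually_nhdsWithin_iff] at this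
    filter_upwards [this] with z hz hzM
    exact mem_ball_iff_norm.1 (hz hzM)
  have hball : ∀ᶠ z in 𝓝 z₀, z ∈ Metric.ball z₀ (r / 2) := Metric.ball_mem_nhds _ (by positivity)
  filter_upwards [tendsto_fst.eventually hr', tendsto_snd.eventually hP,
    tendsto_snd.eventually hball] with p hp hpP hpb hpM w hw w' hw'
  obtain ⟨hcd, hH⟩ := hp
  have hmem : ∀ w ∈ Metric.ball (0 : H) (r / 2), p.2 + w ∈ Metric.ball z₀ r := by
    intro w hw
    rw [mem_ball_iff_norm] at hpb ⊢
    rw [mem_ball_zero_iff] at hw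
    calc ‖p.2 + w - z₀‖ = ‖(p.2 - z₀) + w‖ := by congr 1; abel
      _ ≤ ‖p.2 - z₀‖ + ‖w‖ := norm_add_le _ _
      _ < r := by linarith
  have h1 := norm_gradient_sub_sub_le hcd (convex_ball z₀ r) hH (hmem w' hw') (hmem w hw)
  rw [add_sub_add_left_eq_sub] at h1
  have hsplit : auxMap (L p.1) M p.2 w - auxMap (L p.1) M p.2 w' - augHessian (L 0) M z₀ (w - w')
      = normalProj M p.2 (∇ (L p.1) (p.2 + w) - ∇ (L p.1) (p.2 + w') - A (w - w'))
        + (normalProj M p.2 - normalProj M z₀) (A (w - w'))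
        - (normalProj M p.2 - normalProj M z₀) (w - w') := by
    have e1 : augHessian (L 0) M z₀ (w - w')
      = A (w - w') + ((w - w') - normalProj M z₀ (w - w')) := rfl
    have e2 : normalProj M z₀ (A (w - w')) = A (w - w') := h0.normalProj_hessian hz₀ _
    rw [e1, auxMap, auxMap, sub_apply, sub_apply, e2]
    simp only [map_sub]
    abel
  rw [hsplit]
  have hP' := (hpP hpM).le
  calc _ ≤ ‖normalProj M p.2 (∇ (L p.1) (p.2 + w) - ∇ (L p.1) (p.2 + w') - A (w - w'))‖
        + ‖(normalProj M p.2 - normalProj M z₀) (A (w - w'))‖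
        + ‖(normalProj M p.2 - normalProj M z₀) (w - w')‖ :=
          (norm_sub_le _ _).trans (by gcongr; exact norm_add_le _ _)
    _ ≤ c / 2 * ‖w - w'‖ + τ * (‖A‖ * ‖w - w'‖) + τ * ‖w - w'‖ := by
          gcongr
          · exact (norm_normalProj_le _).trans h1
          · exact (ContinuousLinearMap.le_opNorm _ _).trans
              (by gcongr; exact ContinuousLinearMap.le_opNorm _ _)
          · exact (ContinuousLinearMap.le_opNorm _ _).trans (by gcongr)
    _ = (c / 2 + (τ * ‖A‖ + τ)) * ‖w - w'‖ := by ring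
    _ = c * ‖w - w'‖ := by rw [hτc]; ring

/-- Solvability of the auxiliary equation, with a solution of size `O(ε)`. -/
lemma exists_isAuxSolution (h0 : IsNondegenerateCritical (L 0) M) (hΓ : ContDiff ℝ 2 Γ)
    (hΦ : ContDiff ℝ 2 Φ) (hL : HasSecondOrderExpansion L Γ Φ M) {z₀ : H} (hz₀ : z₀ ∈ M) :
    ∃ C : ℝ, ∀ᶠ p in 𝓝 (0 : ℝ) ×ˢ 𝓝 z₀, p.2 ∈ M →
      ∃ w, ‖w‖ ≤ C * |p.1| ∧ IsAuxSolution (L p.1) M p.2 w := by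
  obtain ⟨b, hb, hbx⟩ := h0.exists_bound hz₀
  obtain ⟨r, hr, hr'⟩ := exists_auxMap_close h0 hΓ hΦ hL hz₀ (c := (2 * b)⁻¹) (by positivity)
  have hbd : ∀ᶠ p in 𝓝 (0 : ℝ) ×ˢ 𝓝 z₀, ‖∇ Γ p.2‖ < ‖∇ Γ z₀‖ + 1 :=
    tendsto_snd.eventually
      ((continuous_gradient hΓ).norm.continuousAt.eventually_lt_const (by linarith))
  -- One unit covers the variation of ∇Γ near `z₀`, the other the o(ε) error in the gradient, so
  -- `auxMap` at 0 has norm at most C'|ε|. A ball of radius ρ is mapped over one of radius (1/b -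
  -- 1/(2b))ρ, whence ρ = 2bC'|ε|.
  set C' := ‖∇ Γ z₀‖ + 2 with hC'
  have hC'0 : 0 < C' := by positivity
  refine ⟨2 * b * C', ?_⟩
  filter_upwards [hr', hbd, eventually_gradient_close h0 hΓ hΦ hL hz₀ one_pos,
    eventually_fst_lt (C := 2 * b * C') hr z₀] with p hp hpb hpg hpr hpM
  set ρ := 2 * b * C' * |p.1| with hρ
  have happrox : ApproximatesLinearOn (auxMap (L p.1) M p.2) (augHessian (L 0) M z₀)
      (Metric.ball 0 r) (Real.toNNReal (2 * b)⁻¹) := by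
    intro x hx y hy
    rw [Real.coe_toNNReal _ (by positivity)]
    exact hp hpM x hx y hy
  have hsurj := (h0.augHessian_bijective hz₀).2
  let inv : (augHessian (L 0) M z₀).NonlinearRightInverse :=
    { toFun := Function.surjInv hsurj
      nnnorm := Real.toNNReal b
      bound' := fun y => by
        rw [Real.coe_toNNReal _ hb.le]
        simpa [Function.surjInv_eq hsurj] using hbx (Function.surjInv hsurj y)
      right_inv' := Function.surjInv_eq hsurj }
  have hsub : Metric.closedBall (0 : H) ρ ⊆ Metric.ball 0 r := Metric.closedBall_subset_ball hpr
  have key := happrox.surjOn_closedBall_of_nonlinearRightInverse inv (by positivity) hsub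
  have hzero : (0 : H) ∈ Metric.closedBall (auxMap (L p.1) M p.2 0)
      (((inv.nnnorm : ℝ)⁻¹ - (Real.toNNReal (2 * b)⁻¹ : ℝ)) * ρ) := by
    have e1 : ((inv.nnnorm : ℝ)⁻¹ - (Real.toNNReal (2 * b)⁻¹ : ℝ)) * ρ = C' * |p.1| := by
      change (((Real.toNNReal b : NNReal) : ℝ)⁻¹ - (Real.toNNReal (2 * b)⁻¹ : ℝ)) * ρ = _
      rw [Real.coe_toNNReal _ (by positivity), Real.coe_toNNReal _ (by positivity), hρ]
      field_simp
      ring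
    rw [e1, mem_closedBall_iff_norm, zero_sub, norm_neg, auxMap, map_zero, sub_zero, add_zero,
      add_zero]
    calc ‖normalProj M p.2 (∇ (L p.1) p.2)‖ ≤ ‖∇ (L p.1) p.2‖ := norm_normalProj_le _
      _ = ‖(∇ (L p.1) p.2 - p.1 • ∇ Γ p.2) + p.1 • ∇ Γ p.2‖ := by rw [sub_add_cancel]
      _ ≤ 1 * |p.1| + |p.1| * (‖∇ Γ z₀‖ + 1) := by
          refine (norm_add_le _ _).trans (add_le_add (hpg hpM) ?_)
          rw [norm_smul, Real.norm_eq_abs]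
          gcongr
      _ = C' * |p.1| := by rw [hC']; ring
  obtain ⟨w, hw, hw0⟩ := key hzero
  exact ⟨w, by simpa using hw, isAuxSolution_iff.2 hw0⟩

/-- Small solutions of the auxiliary equation are locally unique and Lipschitz in `z`. -/
lemma eventually_lipschitz_isAuxSolution (h0 : IsNondegenerateCritical (L 0) M)
    (hΓ : ContDiff ℝ 2 Γ) (hΦ : ContDiff ℝ 2 Φ) (hL : HasSecondOrderExpansion L Γ Φ M) {z₀ : H}
    (hz₀ : z₀ ∈ M) (C : ℝ) :
    ∀ᶠ p in 𝓝 (0 : ℝ) ×ˢ 𝓝 z₀, p.2 ∈ M → ∃ Λ : ℝ, ∀ᶠ z in 𝓝 p.2, z ∈ M →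
      ∀ w w', ‖w‖ ≤ C * |p.1| → ‖w'‖ ≤ C * |p.1| → IsAuxSolution (L p.1) M z w →
        IsAuxSolution (L p.1) M p.2 w' → ‖w - w'‖ ≤ Λ * ‖z - p.2‖ := by
  obtain ⟨b, hb, hbx⟩ := h0.exists_bound hz₀
  obtain ⟨r, hr, hr'⟩ := exists_auxMap_close h0 hΓ hΦ hL hz₀ (c := (2 * b)⁻¹) (by positivity)
  obtain ⟨s, hs, hs'⟩ := exists_hessian_close h0.contDiff hΓ hΦ hL hz₀ one_pos
  obtain ⟨d, hM⟩ := h0.submanifold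
  obtain ⟨κ, hκ, t, ht, hκt⟩ := hM.exists_lipschitz_normalProj hz₀
  have hball : ∀ᶠ z in 𝓝 z₀, z ∈ Metric.ball z₀ (s / 2) := Metric.ball_mem_nhds _ (by positivity)
  set A := hessian (L 0) z₀ with hA
  filter_upwards [hr', tendsto_fst.eventually hs', tendsto_snd.eventually hball.eventually_nhds,
    tendsto_snd.eventually (Filter.Eventually.eventually_nhds (p := (· ∈ t)) ht),
    eventually_fst_lt (C := C) hr z₀,
    eventually_fst_lt (C := C) (half_pos hs) z₀] with p hp hps hpb hpt hCr hCs hpM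
  obtain ⟨hcd, hH⟩ := hps
  set D := ‖∇ (L p.1) p.2‖ + (‖A‖ + 1) * (C * |p.1| + s) + C * |p.1| with hD
  refine ⟨2 * b * ((‖A‖ + 1) + κ * D), ?_⟩
  filter_upwards [hpb, hpt] with z hzb hzt hzM w w' hw hw' haw haw'
  have hpb' := hpb.self_of_nhds
  have hpt' := hpt.self_of_nhds
  have hLip : ∀ u ∈ Metric.ball z₀ s, ∀ v ∈ Metric.ball z₀ s,
      ‖∇ (L p.1) u - ∇ (L p.1) v‖ ≤ (‖A‖ + 1) * ‖u - v‖ := by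
    intro u hu v hv
    have h1 := norm_gradient_sub_sub_le hcd (convex_ball z₀ s) hH hv hu
    calc _ = ‖(∇ (L p.1) u - ∇ (L p.1) v - A (u - v)) + A (u - v)‖ := by rw [sub_add_cancel]
      _ ≤ 1 * ‖u - v‖ + ‖A‖ * ‖u - v‖ :=
        (norm_add_le _ _).trans (add_le_add h1 (ContinuousLinearMap.le_opNorm _ _))
      _ = _ := by ring
  have hmem : ∀ z ∈ Metric.ball z₀ (s / 2), z + w ∈ Metric.ball z₀ s := by
    intro z hz
    rw [mem_ball_iff_norm] at hz ⊢
    calc ‖z + w - z₀‖ = ‖(z - z₀) + w‖ := by congr 1; abel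
      _ ≤ ‖z - z₀‖ + ‖w‖ := norm_add_le _ _
      _ < s := by linarith
  have hsb : Metric.ball z₀ (s / 2) ⊆ Metric.ball z₀ s := Metric.ball_subset_ball (by linarith)
  -- `auxMap` at `p.2` expands distances by at least 1/(2b) and vanishes at `w'`, so its residual at
  -- `w` controls `w - w'`.
  have hinv : ‖w - w'‖ ≤ 2 * b * ‖auxMap (L p.1) M p.2 w‖ := by
    have h1 := hp hpM w (by rw [mem_ball_zero_iff]; linarith) w'
      (by rw [mem_ball_zero_iff]; linarith)
    rw [isAuxSolution_iff.1 haw', sub_zero] at h1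
    have h2 : ‖augHessian (L 0) M z₀ (w - w')‖
        ≤ ‖auxMap (L p.1) M p.2 w‖ + (2 * b)⁻¹ * ‖w - w'‖ := by
      have := norm_sub_norm_le (augHessian (L 0) M z₀ (w - w')) (auxMap (L p.1) M p.2 w)
      rw [norm_sub_rev] at this
      linarith
    have h3 := (hbx (w - w')).trans (mul_le_mul_of_nonneg_left h2 hb.le)
    have h4 : b * ((2 * b)⁻¹ * ‖w - w'‖) = ‖w - w'‖ / 2 := by field_simp
    rw [mul_add, h4] at h3
    linarith
  have hPd : ‖normalProj M p.2 - normalProj M z‖ ≤ κ * ‖z - p.2‖ := by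
    rw [norm_sub_rev z]
    exact hκt _ hpt' _ hzt hpM hzM
  have hDw : ‖∇ (L p.1) (z + w) - w‖ ≤ D := by
    have h1 := hLip _ (hmem z hzb) _ (hsb hpb')
    have h2 : ‖z + w - p.2‖ ≤ C * |p.1| + s := by
      rw [mem_ball_iff_norm] at hzb hpb'
      calc ‖z + w - p.2‖ = ‖(w + (z - z₀)) - (p.2 - z₀)‖ := by congr 1; abel
        _ ≤ ‖w‖ + ‖z - z₀‖ + ‖p.2 - z₀‖ :=
          (norm_sub_le _ _).trans (by gcongr; exact norm_add_le _ _)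
        _ ≤ _ := by linarith
    calc ‖∇ (L p.1) (z + w) - w‖
        = ‖(∇ (L p.1) (z + w) - ∇ (L p.1) p.2) + ∇ (L p.1) p.2 - w‖ := by rw [sub_add_cancel]
      _ ≤ ‖∇ (L p.1) (z + w) - ∇ (L p.1) p.2‖ + ‖∇ (L p.1) p.2‖ + ‖w‖ :=
        (norm_sub_le _ _).trans (by gcongr; exact norm_add_le _ _)
      _ ≤ (‖A‖ + 1) * (C * |p.1| + s) + ‖∇ (L p.1) p.2‖ + C * |p.1| := by
        gcongr
        exact h1.trans (by gcongr)
      _ = D := by rw [hD]; ring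
  -- Subtracting the vanishing `auxMap` at `z` leaves only the effect of moving the base point, in
  -- the gradient and in the projection.
  have hsplit : auxMap (L p.1) M p.2 w
      = normalProj M p.2 (∇ (L p.1) (p.2 + w) - ∇ (L p.1) (z + w))
        + (normalProj M p.2 - normalProj M z) (∇ (L p.1) (z + w) - w) := by
    have h1 := isAuxSolution_iff.1 haw
    rw [← sub_zero (auxMap (L p.1) M p.2 w), ← h1, auxMap, auxMap]
    simp only [map_sub, sub_apply]
    abel
  rw [hsplit] at hinv
  have h1 := hLip _ (hmem _ hpb') _ (hmem z hzb)
  rw [add_sub_add_right_eq_sub, norm_sub_rev p.2] at h1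
  calc ‖w - w'‖ ≤ 2 * b * ((‖A‖ + 1) * ‖z - p.2‖ + κ * ‖z - p.2‖ * D) := by
        refine hinv.trans ?_
        gcongr
        refine (norm_add_le _ _).trans (add_le_add ((norm_normalProj_le _).trans h1) ?_)
        exact (ContinuousLinearMap.le_opNorm _ _).trans (by gcongr)
    _ = _ := by ring

end AuxiliaryEquation

/-! ### The reduced functional: expansion and extrema -/

section ReducedFunctional

variable {H : Type*} [NormedAddCommGroup H] [InnerProductSpace ℝ H] [CompleteSpace H]
  {L : ℝ → H → ℝ} {Γ Φ : H → ℝ} {M : Set H}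

lemma continuousWithinAt_inverseHessian_gradient (h0 : IsNondegenerateCritical (L 0) M)
    (hΓ : ContDiff ℝ 2 Γ) {a : ℝ} (ha : ∀ z ∈ M, Γ z = a) {z₀ : H} (hz₀ : z₀ ∈ M) :
    ContinuousWithinAt (fun z => inverseHessian (L 0) M z (∇ Γ z)) M z₀ :=
  h0.continuousWithinAt_inverseHessian hz₀ (continuous_gradient hΓ).continuousWithinAt
    fun z _ => gradient_mem_normalSpaceOf (hΓ.differentiable two_ne_zero) ha z

lemma continuousOn_reducedTerm (h0 : IsNondegenerateCritical (L 0) M)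
    (hΓ : ContDiff ℝ 2 Γ) (hΦ : ContDiff ℝ 2 Φ) {a : ℝ} (ha : ∀ z ∈ M, Γ z = a) :
    ContinuousOn (reducedTerm (L 0) Γ Φ M) M := fun _ hz =>
  hΦ.continuous.continuousWithinAt.sub (continuousWithinAt_const.mul
    ((continuousWithinAt_inverseHessian_gradient h0 hΓ ha hz).inner
      (continuous_gradient hΓ).continuousWithinAt))

/-- The value of `L_ε` at a solution of the auxiliary equation, up to `o(ε²)`. -/
lemma eventually_reduced_expansion (h0 : IsNondegenerateCritical (L 0) M)
    (hΓ : ContDiff ℝ 2 Γ) (hΦ : ContDiff ℝ 2 Φ) (hL : HasSecondOrderExpansion L Γ Φ M) {a : ℝ}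
    (ha : ∀ z ∈ M, Γ z = a) {z₀ : H} (hz₀ : z₀ ∈ M) {C : ℝ} (hC : 0 ≤ C) {η : ℝ} (hη : 0 < η) :
    ∀ᶠ p in 𝓝 (0 : ℝ) ×ˢ 𝓝 z₀, p.2 ∈ M → ∀ w, ‖w‖ ≤ C * |p.1| → IsAuxSolution (L p.1) M p.2 w →
      |L p.1 (p.2 + w) - (L 0 p.2 + p.1 * a + p.1 ^ 2 * reducedTerm (L 0) Γ Φ M p.2)|
        ≤ η * p.1 ^ 2 := by
  set k : H → H := fun z => inverseHessian (L 0) M z (∇ Γ z) with hk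
  set κ := ‖k z₀‖ + 1 with hκ
  have hκ0 : 0 ≤ κ := by positivity
  -- Total of the error coefficients below, in units of θε²: `E0` and `T2'` count fully, `E1`, `E2`
  -- and `E3'` with weight one half.
  set S := 1 + 3 / 2 * C ^ 2 + 1 / 2 * C + 1 / 2 * (κ * (2 * C + 1)) with hS
  have hS0 : 0 < S := by positivity
  set θ := η / S with hθ
  have hθ0 : 0 < θ := by positivity
  set A := hessian (L 0) z₀ with hA
  obtain ⟨r, hr, hr'⟩ := exists_hessian_close h0.contDiff hΓ hΦ hL hz₀ hθ0
  have hkb : ∀ᶠ z in 𝓝 z₀, z ∈ M → ‖k z‖ < κ := by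
    rw [← eventually_nhdsWithin_iff]
    exact (continuousWithinAt_inverseHessian_gradient h0 hΓ ha hz₀).norm.eventually_lt_const
      (by linarith)
  have hAb : ∀ᶠ z in 𝓝 z₀, hessian (L 0) z ∈ Metric.ball A θ :=
    (continuous_hessian h0.contDiff).continuousAt.eventually (Metric.ball_mem_nhds _ hθ0)
  have hball : ∀ᶠ z in 𝓝 z₀, z ∈ Metric.ball z₀ (r / 2) := Metric.ball_mem_nhds _ (by positivity)
  filter_upwards [tendsto_fst.eventually hr', tendsto_snd.eventually hkb,
    tendsto_snd.eventually hAb, tendsto_snd.eventually hball, (hL.value z₀ hz₀).def hθ0,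
    eventually_gradient_close h0 hΓ hΦ hL hz₀ hθ0,
    eventually_fst_lt (C := C) (half_pos hr) z₀] with p hpr hpk hpA hpb hpv hpg hpC hzM w hw haw
  obtain ⟨ε, z⟩ := p
  dsimp only at *
  obtain ⟨hcd, hH⟩ := hpr
  obtain ⟨hwW, hwP⟩ := haw
  replace hpk := (hpk hzM).le
  replace hpg := hpg hzM
  have hpA' : ‖hessian (L 0) z - A‖ ≤ θ := (mem_ball_iff_norm.1 hpA).le
  obtain ⟨hkW, hkA⟩ := h0.inverseHessian_spec hzM
    (gradient_mem_normalSpaceOf (hΓ.differentiable two_ne_zero) ha z)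
  change k z ∈ _ at hkW
  change hessian (L 0) z (k z) = _ at hkA
  have hzb : z ∈ Metric.ball z₀ r := Metric.ball_subset_ball (by linarith) hpb
  have hzw : z + w ∈ Metric.ball z₀ r := by
    rw [mem_ball_iff_norm] at hpb ⊢
    calc ‖z + w - z₀‖ = ‖(z - z₀) + w‖ := by congr 1; abel
      _ ≤ ‖z - z₀‖ + ‖w‖ := norm_add_le _ _
      _ < r := by linarith
  have hε2 : |ε| * |ε| = ε ^ 2 := by rw [abs_mul_abs_self, sq]
  have hw2 : ‖w‖ ^ 2 ≤ C ^ 2 * ε ^ 2 := by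
    calc ‖w‖ ^ 2 ≤ (C * |ε|) ^ 2 := by gcongr
      _ = C ^ 2 * ε ^ 2 := by rw [mul_pow, sq_abs]
  have T1 := norm_gradient_sub_sub_le hcd (convex_ball z₀ r) hH hzb hzw
  rw [add_sub_cancel_left] at T1
  have T2 := abs_sub_taylor_le hcd (convex_ball z₀ r) hH hzb hzw
  have i1 := inner_eq_zero_of_normalProj_eq_zero hwP hwW
  have i2 := inner_eq_zero_of_normalProj_eq_zero hwP hkW
  have E0 : |L ε z - (L 0 z + ε * a + ε ^ 2 * Φ z)| ≤ θ * ε ^ 2 := by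
    rw [← ha z hzM]
    simpa [remainder] using hpv
  -- Testing the auxiliary equation against `w` turns the quadratic Taylor polynomial into
  -- ½⟨∇L_ε(z), w⟩, up to o(ε²).
  have E1 : |inner ℝ (∇ (L ε) z) w + inner ℝ (A w) w| ≤ θ * (C ^ 2 * ε ^ 2) := by
    have h1 := abs_real_inner_le_norm (∇ (L ε) (z + w) - ∇ (L ε) z - A w) w
    have h2 : inner ℝ (∇ (L ε) (z + w) - ∇ (L ε) z - A w) w
        = -(inner ℝ (∇ (L ε) z) w + inner ℝ (A w) w) := by
      rw [inner_sub_left, inner_sub_left, i1]; ring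
    rw [h2, abs_neg] at h1
    calc _ ≤ ‖∇ (L ε) (z + w) - ∇ (L ε) z - A w‖ * ‖w‖ := h1
      _ ≤ θ * ‖w‖ * ‖w‖ := by gcongr
      _ = θ * ‖w‖ ^ 2 := by ring
      _ ≤ _ := by gcongr
  have E2 : |inner ℝ (∇ (L ε) z) w - ε * inner ℝ (∇ Γ z) w| ≤ θ * (C * ε ^ 2) := by
    have h1 := abs_real_inner_le_norm (∇ (L ε) z - ε • ∇ Γ z) w
    rw [inner_sub_left, real_inner_smul_left] at h1
    calc _ ≤ ‖∇ (L ε) z - ε • ∇ Γ z‖ * ‖w‖ := h1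
      _ ≤ θ * |ε| * (C * |ε|) := by gcongr
      _ = _ := by rw [← hε2]; ring
  -- Testing against `k z` and using symmetry of the Hessian gives ⟨∇Γ, w⟩ directly, with no need
  -- for the expansion of `w` itself.
  have E3 : |inner ℝ (∇ Γ z) w + ε * inner ℝ (k z) (∇ Γ z)| ≤ θ * (κ * (2 * C + 1)) * |ε| := by
    have h1 : inner ℝ (∇ Γ z) w + ε * inner ℝ (k z) (∇ Γ z)
        = inner ℝ ((hessian (L 0) z - A) w - (∇ (L ε) (z + w) - ∇ (L ε) z - A w)
          - (∇ (L ε) z - ε • ∇ Γ z)) (k z) := by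
      have h2 : inner ℝ (∇ Γ z) w = inner ℝ (hessian (L 0) z w) (k z) := by
        rw [← hkA, inner_hessian_comm h0.contDiff, real_inner_comm]
      rw [h2, real_inner_comm (∇ Γ z) (k z)]
      simp only [inner_sub_left, sub_apply, i2, real_inner_smul_left]
      ring
    rw [h1]
    refine (abs_real_inner_le_norm _ _).trans ?_
    calc _ ≤ (θ * (C * |ε|) + θ * (C * |ε|) + θ * |ε|) * κ := by
          gcongr
          refine (norm_sub_le _ _).trans (add_le_add ((norm_sub_le _ _).trans (add_le_add ?_ ?_))
            hpg)
          · exact (ContinuousLinearMap.le_opNorm _ _).trans (by gcongr)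
          · exact T1.trans (by gcongr)
      _ = _ := by ring
  have E3' : |ε * inner ℝ (∇ Γ z) w + ε ^ 2 * inner ℝ (k z) (∇ Γ z)|
      ≤ θ * (κ * (2 * C + 1)) * ε ^ 2 := by
    have h1 : ε * inner ℝ (∇ Γ z) w + ε ^ 2 * inner ℝ (k z) (∇ Γ z)
        = ε * (inner ℝ (∇ Γ z) w + ε * inner ℝ (k z) (∇ Γ z)) := by ring
    rw [h1, abs_mul]
    calc _ ≤ |ε| * (θ * (κ * (2 * C + 1)) * |ε|) := by gcongr
      _ = _ := by rw [← hε2]; ring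
  have T2' : |L ε (z + w) - L ε z - inner ℝ (∇ (L ε) z) w - 1 / 2 * inner ℝ (A w) w|
      ≤ θ * (C ^ 2 * ε ^ 2) := T2.trans (by gcongr)
  have hfin : η * ε ^ 2 = θ * ε ^ 2 + 3 / 2 * (θ * (C ^ 2 * ε ^ 2)) + 1 / 2 * (θ * (C * ε ^ 2))
      + 1 / 2 * (θ * (κ * (2 * C + 1)) * ε ^ 2) := by
    have : η = θ * S := by rw [hθ]; field_simp
    rw [this, hS]; ring
  rw [hfin]
  have hred : reducedTerm (L 0) Γ Φ M z = Φ z - 1 / 2 * inner ℝ (k z) (∇ Γ z) := rfl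
  rw [hred]
  rw [abs_le] at *
  constructor <;> linarith [E0.1, E0.2, E1.1, E1.2, E2.1, E2.2, E3'.1, E3'.2, T2'.1, T2'.2]

/-- At a local extremum of the reduced functional the full gradient vanishes. -/
lemma gradient_eq_zero_of_reduced_extremum (h0 : IsNondegenerateCritical (L 0) M) {f : H → ℝ}
    (hf : Differentiable ℝ f) {z₀ : H} (hz₀ : z₀ ∈ M) {w : H → H} {σ Λ : ℝ} (hσ : |σ| = 1)
    (haux : IsAuxSolution f M z₀ (w z₀))
    (hmem : ∀ᶠ z in 𝓝 z₀, z ∈ M → w z ∈ normalSpaceOf M z)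
    (hext : ∀ᶠ z in 𝓝 z₀, z ∈ M → σ * f (z₀ + w z₀) ≤ σ * f (z + w z))
    (hlip : ∀ᶠ z in 𝓝 z₀, z ∈ M → ‖w z - w z₀‖ ≤ Λ * ‖z - z₀‖)
    (hsmall : ∀ᶠ z in 𝓝 z₀, z ∈ M →
      ‖normalProj M z - normalProj M z₀‖ * ‖w z‖ ≤ 1 / 2 * ‖z - z₀‖) :
    ∇ f (z₀ + w z₀) = 0 := by
  obtain ⟨d, hM⟩ := h0.submanifold
  set u := z₀ + w z₀ with hu
  set ξ := ∇ f u with hξ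
  by_contra hne
  have hξT : ξ ∈ tangentSpaceOf M z₀ := (h0.normalProj_eq_zero_iff hz₀).1 haux.2
  obtain ⟨c, hcM, hc0, hc⟩ := hM.exists_curve hz₀ ((tangentSpaceOf M z₀).smul_mem (-σ) hξT)
  have hct : Tendsto c (𝓝 0) (𝓝 z₀) := hc0 ▸ hc.continuousAt
  set h : ℝ → H := fun s => c s - z₀ + (w (c s) - w z₀) with hh
  have hcO : (fun s => c s - z₀) =O[𝓝 0] fun s => s := by
    simpa [hc0] using hc.isBigO_sub
  have hwO : (fun s => w (c s) - w z₀) =O[𝓝 0] fun s => c s - z₀ := by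
    refine Asymptotics.IsBigO.of_bound Λ ?_
    filter_upwards [hct.eventually hlip, hcM] with s hs hsM using hs hsM
  have hhO : h =O[𝓝 0] fun s => s := hcO.add (hwO.trans hcO)
  have hht : Tendsto h (𝓝 0) (𝓝 0) := hhO.trans_tendsto tendsto_id
  -- The displacement `h` need not be differentiable; being O(s) is enough to make the Taylor error
  -- o(s).
  have hto : (fun s => f (u + h s) - f u - inner ℝ ξ (h s)) =o[𝓝 0] fun s => s := by
    have h1 := (hasFDerivAt_iff_isLittleO_nhds_zero.1 (hf u).hasFDerivAt).comp_tendsto hht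
    refine (h1.trans_isBigO hhO).congr_left fun s => ?_
    simp [hξ, inner_gradient_left]
  have hineq : ∀ᶠ s in 𝓝 (0 : ℝ), 0 ≤ σ * (f (u + h s) - f u - inner ℝ ξ (h s))
      + σ * inner ℝ ξ (c s - z₀) + 1 / 2 * ‖ξ‖ * ‖c s - z₀‖ := by
    filter_upwards [hct.eventually hmem, hct.eventually hext, hct.eventually hsmall, hcM] with
      s h1 h2 h3 h4
    replace h1 := h1 h4
    replace h2 := h2 h4
    replace h3 := h3 h4
    have e1 : u + h s = c s + w (c s) := by rw [hu, hh]; dsimp only; abel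
    have e2 : inner ℝ ξ (w z₀) = 0 := inner_eq_zero_of_normalProj_eq_zero haux.2 haux.1
    -- ξ is orthogonal to W_{z₀} and `w (c s)` lies in W_{c s}, so only the change of the projection
    -- contributes.
    have e3 : inner ℝ ξ (w (c s))
        = inner ℝ ((normalProj M (c s) - normalProj M z₀) ξ) (w (c s)) := by
      have h5 : normalProj M z₀ ξ = 0 := haux.2
      rw [sub_apply, h5, sub_zero, inner_normalProj, normalProj_eq_self_iff.2 h1]
    have e4 : |inner ℝ ξ (w (c s))| ≤ 1 / 2 * ‖ξ‖ * ‖c s - z₀‖ := by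
      rw [e3]
      calc _ ≤ ‖(normalProj M (c s) - normalProj M z₀) ξ‖ * ‖w (c s)‖ :=
            abs_real_inner_le_norm _ _
        _ ≤ (‖normalProj M (c s) - normalProj M z₀‖ * ‖ξ‖) * ‖w (c s)‖ := by
          gcongr; exact ContinuousLinearMap.le_opNorm _ _
        _ = ‖ξ‖ * (‖normalProj M (c s) - normalProj M z₀‖ * ‖w (c s)‖) := by ring
        _ ≤ ‖ξ‖ * (1 / 2 * ‖c s - z₀‖) := by gcongr
        _ = _ := by ring
    have e5 : inner ℝ ξ (h s) = inner ℝ ξ (c s - z₀) + inner ℝ ξ (w (c s)) := by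
      rw [hh]; dsimp only; rw [inner_add_right, inner_sub_right ξ (w (c s)), e2, sub_zero]
    have e6 : -(1 / 2 * ‖ξ‖ * ‖c s - z₀‖) ≤ -(σ * inner ℝ ξ (w (c s))) := by
      rw [neg_le_neg_iff]
      refine (le_abs_self _).trans ?_
      rwa [abs_mul, hσ, one_mul]
    rw [e5, e1]
    linarith
  have hq : Tendsto (fun s : ℝ => s⁻¹ • (c s - z₀)) (𝓝[>] 0) (𝓝 (-σ • ξ)) := by
    have h1 := hasDerivAt_iff_tendsto_slope.1 hc
    refine (h1.mono_left (nhdsWithin_mono _ fun s hs => ne_of_gt hs)).congr fun s => ?_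
    simp [slope_def_module, hc0]
  -- The limit as s → 0⁺ is -‖ξ‖² + ½‖ξ‖², since σ² = 1; the extremality makes it nonnegative.
  have hlim : Tendsto (fun s : ℝ => σ * ((f (u + h s) - f u - inner ℝ ξ (h s)) / s)
      + σ * inner ℝ ξ (s⁻¹ • (c s - z₀)) + 1 / 2 * ‖ξ‖ * ‖s⁻¹ • (c s - z₀)‖) (𝓝[>] 0)
      (𝓝 (σ * 0 + σ * inner ℝ ξ (-σ • ξ) + 1 / 2 * ‖ξ‖ * ‖-σ • ξ‖)) :=
    (((hto.tendsto_div_nhds_zero.mono_left nhdsWithin_le_nhds).const_mul σ).add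
      ((tendsto_const_nhds.inner hq).const_mul σ)).add (hq.norm.const_mul _)
  have hnonneg := ge_of_tendsto (b := 0) hlim (by
    filter_upwards [nhdsWithin_le_nhds hineq, self_mem_nhdsWithin] with s hs hs0
    replace hs0 : 0 < s := hs0
    have h1 := mul_nonneg (inv_nonneg.2 hs0.le) hs
    rw [real_inner_smul_right, norm_smul, Real.norm_eq_abs, abs_of_pos (inv_pos.2 hs0)]
    calc (0 : ℝ) ≤ _ := h1
      _ = _ := by ring)
  have hσ2 : σ * σ = 1 := by rw [← abs_mul_abs_self, hσ, one_mul]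
  rw [norm_smul, norm_neg, Real.norm_eq_abs, hσ, real_inner_smul_right,
    real_inner_self_eq_norm_mul_norm] at hnonneg
  have h1 : 0 < ‖ξ‖ * ‖ξ‖ := by
    have := norm_pos_iff.2 hne
    positivity
  have h2 : σ * 0 + σ * (-σ * (‖ξ‖ * ‖ξ‖)) + 1 / 2 * ‖ξ‖ * (1 * ‖ξ‖)
      = -(σ * σ) * (‖ξ‖ * ‖ξ‖) + 1 / 2 * (‖ξ‖ * ‖ξ‖) := by ring
  rw [h2, hσ2] at hnonneg
  linarith

end ReducedFunctional

/-! ### Existence of critical points over compact sets -/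

section Existence

variable {H : Type*} [NormedAddCommGroup H] [InnerProductSpace ℝ H] [CompleteSpace H]
  {L : ℝ → H → ℝ} {Γ Φ : H → ℝ} {M : Set H}

/-- Uniform solvability of the auxiliary equation over a compact part of `M`. -/
lemma exists_isAuxSolution_of_isCompact (h0 : IsNondegenerateCritical (L 0) M)
    (hΓ : ContDiff ℝ 2 Γ) (hΦ : ContDiff ℝ 2 Φ) (hL : HasSecondOrderExpansion L Γ Φ M) {K : Set H}
    (hK : IsCompact K) (hKM : K ⊆ M) :
    ∃ C : ℝ, 0 ≤ C ∧ ∀ᶠ ε in 𝓝 (0 : ℝ), ∀ z ∈ K,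
      ∃ w, ‖w‖ ≤ C * |ε| ∧ IsAuxSolution (L ε) M z w := by
  suffices h : ∃ C : ℝ, 0 ≤ C ∧ ∀ᶠ ε in 𝓝 (0 : ℝ), ∀ z ∈ K, z ∈ M →
      ∃ w, ‖w‖ ≤ C * |ε| ∧ IsAuxSolution (L ε) M z w by
    obtain ⟨C, hC, h⟩ := h
    exact ⟨C, hC, h.mono fun ε hε z hz => hε z hz (hKM hz)⟩
  refine hK.induction_on (p := fun s => ∃ C : ℝ, 0 ≤ C ∧ ∀ᶠ ε in 𝓝 (0 : ℝ), ∀ z ∈ s, z ∈ M →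
      ∃ w, ‖w‖ ≤ C * |ε| ∧ IsAuxSolution (L ε) M z w) ⟨0, le_rfl, by simp⟩ ?_ ?_ ?_
  · rintro s t hst ⟨C, hC, h⟩
    exact ⟨C, hC, h.mono fun ε hε z hz => hε z (hst hz)⟩
  · rintro s t ⟨C, hC, h⟩ ⟨D, hD, h'⟩
    refine ⟨max C D, le_max_of_le_left hC, ?_⟩
    filter_upwards [h, h'] with ε hε hε' z hz hzM
    rcases hz with hz | hz
    · obtain ⟨w, hw, haw⟩ := hε z hz hzM
      exact ⟨w, hw.trans (by gcongr; exact le_max_left _ _), haw⟩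
    · obtain ⟨w, hw, haw⟩ := hε' z hz hzM
      exact ⟨w, hw.trans (by gcongr; exact le_max_right _ _), haw⟩
  · intro z hz
    obtain ⟨C, hC⟩ := exists_isAuxSolution h0 hΓ hΦ hL (hKM hz)
    obtain ⟨pa, ha, pb, hb, h⟩ := eventually_prod_iff.1 hC
    refine ⟨{z | pb z}, nhdsWithin_le_nhds hb, max C 0, le_max_right _ _, ?_⟩
    filter_upwards [ha] with ε hε z hz hzM
    obtain ⟨w, hw, haw⟩ := h hε hz hzM
    exact ⟨w, hw.trans (by gcongr; exact le_max_left _ _), haw⟩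

/-- If the reduced term has on the compact set `K` a value that beats (for `σ = 1` from below, for
`σ = -1` from above) all its values on `B`, and `K` is a neighborhood in `M` of the points of
`K \ B`, then `L_ε` has a critical point near `K \ B`. -/
lemma exists_critical_of_isolated_extremum (h0 : IsNondegenerateCritical (L 0) M)
    (hΓ : ContDiff ℝ 2 Γ) (hΦ : ContDiff ℝ 2 Φ) (hL : HasSecondOrderExpansion L Γ Φ M) {a : ℝ}
    (ha : ∀ z ∈ M, Γ z = a) {K B : Set H} (hK : IsCompact K) (hKM : K ⊆ M)
    (hKB : ∀ z ∈ K, z ∉ B → ∀ᶠ z' in 𝓝 z, z' ∈ M → z' ∈ K) {σ : ℝ} (hσ : |σ| = 1) {c : ℝ}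
    (hc : 0 < c) {z₁ : H} (hz₁ : z₁ ∈ K)
    (hB : ∀ z ∈ B, σ * reducedTerm (L 0) Γ Φ M z₁ + c ≤ σ * reducedTerm (L 0) Γ Φ M z) :
    ∃ ε₀ > 0, ∃ C : ℝ, ∀ ε : ℝ, |ε| < ε₀ → ∃ z ∈ K, z ∉ B ∧ ∃ w ∈ normalSpaceOf M z,
      ‖w‖ ≤ C * |ε| ∧ HasGradientAt (L ε) 0 (z + w) := by
  obtain ⟨d, hM⟩ := h0.submanifold
  have hgrad : ∀ {f : H → ℝ} {u : H}, Differentiable ℝ f → ∇ f u = 0 → HasGradientAt f 0 u :=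
    fun hf h => h ▸ (hf _).hasGradientAt
  have hd0 : Differentiable ℝ (L 0) := h0.contDiff.differentiable two_ne_zero
  obtain ⟨C, hC, hsol⟩ := exists_isAuxSolution_of_isCompact h0 hΓ hΦ hL hK hKM
  -- Compactness of `K` turns statements near each (0, z) into statements for all z ∈ K and all
  -- small ε.
  have hlip := hK.eventually_forall_of_forall_eventually (x₀ := (0 : ℝ))
    (P := fun ε z => z ∈ M → ∃ Λ : ℝ, ∀ᶠ z' in 𝓝 z, z' ∈ M →
      ∀ w w', ‖w‖ ≤ C * |ε| → ‖w'‖ ≤ C * |ε| → IsAuxSolution (L ε) M z' w →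
        IsAuxSolution (L ε) M z w' → ‖w - w'‖ ≤ Λ * ‖z' - z‖) fun z hz => by
    rw [nhds_prod_eq]
    exact eventually_lipschitz_isAuxSolution h0 hΓ hΦ hL (hKM hz) C
  have hexp := hK.eventually_forall_of_forall_eventually (x₀ := (0 : ℝ))
    (P := fun ε z => z ∈ M → ∀ w, ‖w‖ ≤ C * |ε| → IsAuxSolution (L ε) M z w →
      |L ε (z + w) - (L 0 z + ε * a + ε ^ 2 * reducedTerm (L 0) Γ Φ M z)|
        ≤ c / 3 * ε ^ 2) fun z hz => by
    rw [nhds_prod_eq]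
    exact eventually_reduced_expansion h0 hΓ hΦ hL ha (hKM hz) hC (by positivity)
  have hproj := hK.eventually_forall_of_forall_eventually (x₀ := (0 : ℝ))
    (P := fun ε z => z ∈ M → ∀ᶠ z' in 𝓝 z, z' ∈ M →
      ‖normalProj M z' - normalProj M z‖ * (C * |ε|) ≤ 1 / 2 * ‖z' - z‖) fun z hz => by
    rw [nhds_prod_eq]
    obtain ⟨κ, hκ, t, ht, hκt⟩ := hM.exists_lipschitz_normalProj (hKM hz)
    filter_upwards [tendsto_snd.eventually (Filter.Eventually.eventually_nhds (p := (· ∈ t)) ht),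
      eventually_fst_lt (C := κ * C) (half_pos one_pos) z] with p hp hpC hpM
    filter_upwards [hp] with z' hz' hzM'
    calc _ ≤ (κ * ‖z' - p.2‖) * (C * |p.1|) := by
          gcongr; exact hκt _ hz' _ hp.self_of_nhds hzM' hpM
      _ = (κ * C * |p.1|) * ‖z' - p.2‖ := by ring
      _ ≤ _ := by gcongr
  obtain ⟨ε₀, hε₀, hall⟩ := Metric.eventually_nhds_iff_ball.1
    (hsol.and (hlip.and (hexp.and (hproj.and hL.contDiff))))
  refine ⟨ε₀, hε₀, C, fun ε hε => ?_⟩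
  obtain ⟨hsol, hlip, hexp, hproj, hcd⟩ := hall ε (by simpa using hε)
  -- The gap cε² degenerates at ε = 0, where `z₁` itself is critical.
  by_cases hε0 : ε = 0
  · subst hε0
    refine ⟨z₁, hz₁, fun h => by linarith [hB z₁ h], 0, Submodule.zero_mem _, by simp, ?_⟩
    rw [add_zero]
    exact hgrad hd0 (h0.gradient_eq_zero _ (hKM hz₁))
  have hε2 : 0 < ε ^ 2 := by positivity
  choose! w hwn hwa using hsol
  -- L₀ may differ between components of `M` by amounts that swamp ε²; fixing its value leaves Φ̂ as
  -- the first varying term.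
  set K₁ := K ∩ {z | L 0 z = L 0 z₁} with hK₁
  have hK₁c : IsCompact K₁ :=
    hK.inter_right (isClosed_eq hd0.continuous continuous_const)
  have hwlip : ∀ z ∈ K, ∃ Λ : ℝ, ∀ᶠ z' in 𝓝 z, z' ∈ K → ‖w z' - w z‖ ≤ Λ * ‖z' - z‖ := by
    intro z hz
    obtain ⟨Λ, hΛ⟩ := hlip z hz (hKM hz)
    refine ⟨Λ, hΛ.mono fun z' h hz' => ?_⟩
    exact h (hKM hz') _ _ (hwn z' hz') (hwn z hz) (hwa z' hz') (hwa z hz)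
  have hwc : ContinuousOn w K := by
    intro z hz
    obtain ⟨Λ, hΛ⟩ := hwlip z hz
    rw [ContinuousWithinAt, tendsto_iff_norm_sub_tendsto_zero]
    have h1 : Tendsto (fun z' => Λ * ‖z' - z‖) (𝓝[K] z) (𝓝 0) := by
      have : Continuous fun z' : H => Λ * ‖z' - z‖ := by fun_prop
      simpa using (this.tendsto z).mono_left nhdsWithin_le_nhds
    refine squeeze_zero' (Eventually.of_forall fun _ => norm_nonneg _) ?_ h1
    exact eventually_nhdsWithin_iff.2 hΛ
  have hφc : ContinuousOn (fun z => σ * L ε (z + w z)) K₁ :=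
    continuousOn_const.mul (hcd.continuous.comp_continuousOn
      (continuousOn_id.add (hwc.mono inter_subset_left)))
  have hz₁K : z₁ ∈ K₁ := ⟨hz₁, rfl⟩
  obtain ⟨z, hzK, hzmin⟩ := hK₁c.exists_isMinOn ⟨z₁, hz₁K⟩ hφc
  have hest : ∀ y ∈ K₁, |σ * L ε (y + w y) - (σ * (L 0 z₁ + ε * a)
      + ε ^ 2 * (σ * reducedTerm (L 0) Γ Φ M y))| ≤ c / 3 * ε ^ 2 := by
    intro y hy
    have h1 := hexp y hy.1 (hKM hy.1) (w y) (hwn y hy.1) (hwa y hy.1)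
    have h2 : L 0 y = L 0 z₁ := hy.2
    rw [h2, ← one_mul |_|, ← hσ, ← abs_mul] at h1
    have h3 : σ * L ε (y + w y) - (σ * (L 0 z₁ + ε * a)
        + ε ^ 2 * (σ * reducedTerm (L 0) Γ Φ M y)) = σ * (L ε (y + w y)
        - (L 0 z₁ + ε * a + ε ^ 2 * reducedTerm (L 0) Γ Φ M y)) := by ring
    rwa [h3]
  -- Two errors of cε²/3 cannot close the gap cε² between `z₁` and a point of `B`.
  have hzB : z ∉ B := by
    intro hz
    have h1 := (abs_le.1 (hest z hzK)).1
    have h2 := (abs_le.1 (hest z₁ hz₁K)).2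
    have h3 : σ * L ε (z + w z) ≤ σ * L ε (z₁ + w z₁) := hzmin hz₁K
    have h4 := mul_le_mul_of_nonneg_left (hB z hz) hε2.le
    have h5 := mul_pos hε2 hc
    linarith
  have hnear : ∀ᶠ z' in 𝓝 z, z' ∈ M → z' ∈ K₁ := by
    have h1 : ∀ z ∈ M, fderiv ℝ (L 0) z = 0 := fun z hz => by
      rw [← toDual_gradient, h0.gradient_eq_zero z hz, map_zero]
    filter_upwards [hKB z hzK.1 hzB,
      hM.eventually_eq_of_fderiv_eq_zero hd0 h1 (hKM hzK.1)] with z' h2 h3 hz'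
    exact ⟨h2 hz', (h3 hz').trans hzK.2⟩
  obtain ⟨Λ, hΛ⟩ := hwlip z hzK.1
  refine ⟨z, hzK.1, hzB, w z, (hwa z hzK.1).1, hwn z hzK.1,
    hgrad (hcd.differentiable two_ne_zero) ?_⟩
  refine gradient_eq_zero_of_reduced_extremum h0 (hcd.differentiable two_ne_zero) (hKM hzK.1)
    (Λ := Λ) hσ (hwa z hzK.1) ?_ ?_ ?_ ?_
  · filter_upwards [hnear] with z' h hz' using (hwa z' (h hz').1).1
  · filter_upwards [hnear] with z' h hz' using hzmin (h hz')
  · filter_upwards [hnear, hΛ] with z' h h' hz' using h' (h hz').1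
  · filter_upwards [hnear, hproj z hzK.1 (hKM hzK.1)] with z' h h' hz'
    refine le_trans ?_ (h' hz')
    gcongr
    exact hwn z' (h hz').1

end Existence

end DegeneratePerturbation

end

/-! ### The main theorem -/

theorem theorem2p5
    {H : Type*} [NormedAddCommGroup H] [InnerProductSpace ℝ H] [CompleteSpace H]
    -- the fiber `G` and the compact base `N`, finite-dimensional manifolds without boundary
    {E F : Type*} [NormedAddCommGroup E] [NormedSpace ℝ E] [FiniteDimensional ℝ E]
    [NormedAddCommGroup F] [NormedSpace ℝ F] [FiniteDimensional ℝ F]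
    {G : Type*} [TopologicalSpace G] [ChartedSpace E G] [IsManifold 𝓘(ℝ, E) 2 G]
    {N : Type*} [TopologicalSpace N] [ChartedSpace F N] [IsManifold 𝓘(ℝ, F) 2 N]
    [CompactSpace N] [Nonempty N]
    -- the family `L_ε = L_0 + ε Γ + ε² Φ + o(ε²)`
    (L : ℝ → H → ℝ) (Γ Φ : H → ℝ) (d : ℕ) (M : Set H) (ι : G × N → H)
    (hL₀ : ContDiff ℝ 2 (L 0)) (hΓ : ContDiff ℝ 2 Γ) (hΦ : ContDiff ℝ 2 Φ)
    (hL : DegeneratePerturbation.HasSecondOrderExpansion L Γ Φ M)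
    -- `M` is a non-degenerate critical manifold of `L_0`
    (hM : DegeneratePerturbation.IsC2Submanifold d M)
    (hcrit : ∀ z ∈ M, (∇ (L 0)) z = 0)
    (hker : ∀ z ∈ M, DegeneratePerturbation.tangentSpaceOf M z =
      (DegeneratePerturbation.hessian (L 0) z).ker)
    (hfred : ∀ z ∈ M, DegeneratePerturbation.IsFredholmIndexZero
      (DegeneratePerturbation.hessian (L 0) z))
    -- `M` is globally trivialized by `ι`, and the base directions are degenerate for `Γ`
    (hι : DegeneratePerturbation.IsC2DiffeoOnto (E := E) (F := F) ι M)
    (hdeg : ∀ (g : G) (γ : N) (v : TangentSpace 𝓘(ℝ, F) γ),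
      mfderiv (𝓘(ℝ, E).prod 𝓘(ℝ, F)) 𝓘(ℝ, ℝ) (Γ ∘ ι) (g, γ) ((0 : E), v) = 0)
    (hconst : ∃ a : ℝ, ∀ p : G × N, Γ (ι p) = a)
    (U : Set G) (hU : IsOpen U) (hUc : IsCompact (closure U))
    (hmin :
      DegeneratePerturbation.HasUniformInteriorMin
        (fun p : G × N => DegeneratePerturbation.reducedTerm (L 0) Γ Φ M (ι p)) U ∨
      DegeneratePerturbation.HasUniformInteriorMax
        (fun p : G × N => DegeneratePerturbation.reducedTerm (L 0) Γ Φ M (ι p)) U) :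
    -- `L_ε` has a critical point `z + w`, with `z ∈ ι(U × N)` and `w ⟂ T_z M` of size `O(ε)`
    ∃ ε₀ > 0, ∃ C : ℝ, ∀ ε : ℝ, |ε| < ε₀ →
      ∃ g ∈ U, ∃ γ : N, ∃ w ∈ DegeneratePerturbation.normalSpaceOf M (ι (g, γ)),
        ‖w‖ ≤ C * |ε| ∧ HasGradientAt (L ε) 0 (ι (g, γ) + w) := by
  open DegeneratePerturbation in
  obtain ⟨hιs, hrange, κ, hκ, hκs⟩ := hι
  obtain ⟨a, ha⟩ := hconst
  have h0 : IsNondegenerateCritical (L 0) M := ⟨hL₀, ⟨d, hM⟩, hcrit, hker, hfred⟩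
  have haM : ∀ z ∈ M, Γ z = a := by
    rw [← hrange]; rintro _ ⟨p, rfl⟩; exact ha p
  have hιM : ∀ p, ι p ∈ M := fun p => hrange ▸ mem_range_self p
  -- The sign σ merges the minimum and maximum cases into a single minimization.
  obtain ⟨σ, hσ, c, hc, hext⟩ : ∃ σ : ℝ, |σ| = 1 ∧ ∃ c > 0, ∀ γ : N, ∃ g₀ ∈ closure U,
      ∀ g ∈ frontier U, σ * reducedTerm (L 0) Γ Φ M (ι (g₀, γ)) + c
        ≤ σ * reducedTerm (L 0) Γ Φ M (ι (g, γ)) := by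
    rcases hmin with ⟨c, hc, h⟩ | ⟨c, hc, h⟩
    · exact ⟨1, abs_one, c, hc, by simpa using h⟩
    · refine ⟨-1, by simp, c, hc, fun γ => ?_⟩
      obtain ⟨g₀, hg₀, h⟩ := h γ
      exact ⟨g₀, hg₀, fun g hg => by linarith [h g hg]⟩
  set K := ι '' (closure U ×ˢ (univ : Set N)) with hKdef
  have hK : IsCompact K := (hUc.prod isCompact_univ).image hιs.continuous
  have hKM : K ⊆ M := by rintro _ ⟨p, -, rfl⟩; exact hιM p
  have hKne : K.Nonempty := by
    obtain ⟨γ⟩ := ‹Nonempty N›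
    obtain ⟨g₀, hg₀, -⟩ := hext γ
    exact ⟨_, (g₀, γ), ⟨hg₀, mem_univ _⟩, rfl⟩
  obtain ⟨z₁, hz₁, hz₁min⟩ := hK.exists_isMinOn hKne
    (continuousOn_const.mul ((continuousOn_reducedTerm h0 hΓ hΦ haM).mono hKM) :
      ContinuousOn (fun z => σ * reducedTerm (L 0) Γ Φ M z) K)
  have hmemU : ∀ z ∈ K, z ∉ ι '' (frontier U ×ˢ (univ : Set N)) → ∃ g ∈ U, ∃ γ : N,
      ι (g, γ) = z := by
    rintro _ ⟨⟨g, γ⟩, ⟨hg, -⟩, rfl⟩ hB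
    refine ⟨g, ?_, γ, rfl⟩
    by_contra hgU
    refine hB ⟨(g, γ), ⟨⟨hg, ?_⟩, mem_univ _⟩, rfl⟩
    rwa [hU.interior_eq]
  have hnear : ∀ z ∈ K, z ∉ ι '' (frontier U ×ˢ (univ : Set N)) →
      ∀ᶠ z' in 𝓝 z, z' ∈ M → z' ∈ K := by
    intro z hz hzB
    obtain ⟨g, hg, γ, rfl⟩ := hmemU z hz hzB
    -- Continuity of the inverse of ι on `M` makes ι(U×N) relatively open in `M`.
    have h1 : ContinuousWithinAt κ M (ι (g, γ)) := hκs.continuousOn _ (hιM _)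
    have h2 : U ×ˢ (univ : Set N) ∈ 𝓝 (κ (ι (g, γ))) := by
      rw [hκ]
      exact (hU.prod isOpen_univ).mem_nhds ⟨hg, mem_univ _⟩
    filter_upwards [eventually_nhdsWithin_iff.1 (h1.eventually_mem h2)] with z' h3 hz'
    have h4 := h3 hz'
    rw [← hrange] at hz'
    obtain ⟨p, rfl⟩ := hz'
    rw [hκ] at h4
    exact ⟨p, ⟨subset_closure h4.1, mem_univ _⟩, rfl⟩
  have hbd : ∀ z ∈ ι '' (frontier U ×ˢ (univ : Set N)),
      σ * reducedTerm (L 0) Γ Φ M z₁ + c ≤ σ * reducedTerm (L 0) Γ Φ M z := by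
    rintro _ ⟨⟨g, γ⟩, ⟨hg, -⟩, rfl⟩
    obtain ⟨g₀, hg₀, h⟩ := hext γ
    -- The global minimizer `z₁` on `K` is at least as good as the competitor `g₀` in each fiber, so
    -- it inherits the uniform gap.
    have h1 : σ * reducedTerm (L 0) Γ Φ M z₁ ≤ σ * reducedTerm (L 0) Γ Φ M (ι (g₀, γ)) :=
      hz₁min ⟨(g₀, γ), ⟨hg₀, mem_univ _⟩, rfl⟩
    linarith [h g hg]
  obtain ⟨ε₀, hε₀, C, h⟩ := exists_critical_of_isolated_extremum h0 hΓ hΦ hL haM hK hKM hnear hσ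
    hc hz₁ hbd
  refine ⟨ε₀, hε₀, C, fun ε hε => ?_⟩
  obtain ⟨z, hz, hzB, w, hw, hwC, hcr⟩ := h ε hε
  obtain ⟨g, hg, γ, rfl⟩ := hmemU z hz hzB
  exact ⟨g, hg, γ, w, hw, hwC, hcr⟩
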